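/- **Notation.** Let $N,M\ge 1$. For $I=(I_1,\dots,I_N)$ and $J=(J_1,\dots,J_M)$ let $\mathbb H^{I(N)\times J(M)}$ be the set of quaternion tensors $(a_{i_1\dots i_N j_1\dots j_M})$ with $1\le i_s\le I_s$, $1\le j_s\le J_s$. Juxtaposition denotes the Einstein product: for $\mathcal A\in\mathbb H^{I(N)\times J(M)}$ and $\mathcal B\in\mathbb H^{J(M)\times K(P)}$, $(\mathcal A\mathcal B)_{i_1\dots i_Nk_1\dots k_P}=\sum_{j_1,\dots,j_M}a_{i_1\dots i_Nj_1\dots j_M}b_{j_1\dots j_Mk_1\dots k_P}$. $\mathcal I$ is the unit tensor and $*$ the conjugate transpose. $\mathcal D^\dagger$ is the Moore–Penrose inverse: the unique tensor with $\mathcal D\mathcal D^\dagger\mathcal D=\mathcal D$, $\mathcal D^\dagger\mathcal D\mathcal D^\dagger=\mathcal D^\dagger$, $(\mathcal D\mathcal D^\dagger)^*=\mathcal D\mathcal D^\dagger$, $(\mathcal D^\dagger\mathcal D)^*=\mathcal D^\dagger\mathcal D$; and $R_{\mathcal D}=\mathcal I-\mathcal D\mathcal D^\dagger$, $L_{\mathcal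 D}=\mathcal I-\mathcal D^\dagger\mathcal D$. For $\mathcal A\in\mathbb H^{I(N)\times J(M)}$, $\mathcal B\in\mathbb H^{I(N)\times K(M)}$, the row block tensor $(\mathcal A\ \ \mathcal B)$ has column index $(l_1,\dots,l_M)$ with $1\le l_s\le J_s+K_s$; its entry is that of $\mathcal A$ if all $l_s\le J_s$, that of $\mathcal B$ at $(l_s-J_s)_s$ if all $l_s>J_s$, and $0$ otherwise. The column block tensor $\binom{\mathcal A}{\mathcal B}$ is defined in the same way on row indices. In the formulas below $(\mathcal I\ \ 0)$ and $\binom{\mathcal I}{0}$ have two blocks of equal format. **Data.** Let $A_1\in\mathbb H^{I(N)\times J(N)}$, $A_2\in\mathbb H^{I(N)\times Q(N)}$, $A_3\in\mathbb H^{I(N)\times P(N)}$, $A_4,A_6\in\mathbb H^{A(N)\times E(N)}$, $A_5,A_8\in\mathbb H^{C(N)\times V(N)}$, $A_7\in\mathbb H^{A(N)\times G(N)}$, $A_9\in\mathbb H^{C(N)\times G(N)}$, $B_1\in\mathbb H^{L(M)\times K(M)}$, $B_2\in\mathbb H^{S(M)\times K(M)}$, $B_3\in\mathbb H^{T(M)\times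 K(M)}$, $B_4,B_7\in\mathbb H^{H(M)\times B(M)}$, $B_5\in\mathbb H^{U(M)\times D(M)}$, $B_6\in\mathbb H^{F(M)\times B(M)}$, $B_8\in\mathbb H^{D(M)\times R(M)}$, $B_9\in\mathbb H^{U(M)\times R(M)}$, $C_3\in\mathbb H^{G(N)\times J(N)}$, $C_4,H_4\in\mathbb H^{G(N)\times P(N)}$, $H_3\in\mathbb H^{G(N)\times Q(N)}$, $D_3\in\mathbb H^{L(M)\times F(M)}$, $D_4\in\mathbb H^{T(M)\times F(M)}$, $J_3\in\mathbb H^{S(M)\times D(M)}$, $J_4\in\mathbb H^{T(M)\times D(M)}$, $E_1,E_2\in\mathbb H^{I(N)\times K(M)}$, $E_3\in\mathbb H^{I(N)\times T(M)}$, $E_4\in\mathbb H^{P(N)\times K(M)}$, $E_5\in\mathbb H^{A(N)\times F(M)}$, $E_6\in\mathbb H^{G(N)\times B(M)}$, $E_7\in\mathbb H^{C(N)\times D(M)}$, $E_8\in\mathbb H^{G(N)\times D(M)}$, $E_9\in\mathbb H^{A(N)\times B(M)}$, $E_{10}\in\mathbb H^{C(N)\times R(M)}$ be given. Consider the system in the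 unknowns $X_1,X_2,Y_1,Y_2,X_3,Y_3,W$ of formats $E(N)\times F(M)$, $G(N)\times H(M)$, $V(N)\times D(M)$, $G(N)\times U(M)$, $J(N)\times L(M)$, $Q(N)\times S(M)$, $P(N)\times T(M)$: $$\begin{aligned} &A_1X_3B_1=E_1,\quad A_2Y_3B_2=E_2,\quad A_4X_1=E_5,\quad X_2B_4=E_6,\quad A_5Y_1=E_7,\quad Y_2B_5=E_8,\quad A_3W=E_3,\quad WB_3=E_4,\\ &A_6X_1B_6+A_7X_2B_7+A_7(C_3X_3D_3+C_4WD_4)B_6=E_9,\\ &A_8Y_1B_8+A_9Y_2B_9+A_9(H_3Y_3J_3+H_4WJ_4)B_8=E_{10}. \end{aligned}\tag{$*$}$$ **Derived tensors.** Set $$\begin{aligned} &\hat A_6=A_6L_{A_4},\ \hat B_7=R_{B_4}B_7,\ \hat E_9=E_9-A_6A_4^\dagger E_5B_6-A_7E_6B_4^\dagger B_7,\ M_{11}=R_{\hat A_6}A_7,\ N_{11}=\hat B_7L_{B_6},\ S_{11}=A_7L_{M_{11}},\\ &\hat A_4=M_{11}C_3,\ \hat C_4=M_{11}C_4,\ \hat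 B_4=D_3B_6L_{\hat B_7},\ \hat D_4=D_4B_6L_{\hat B_7},\ \hat P=R_{\hat A_6}\hat E_9L_{\hat B_7},\\ &\hat A_8=A_8L_{A_5},\ \hat B_9=R_{B_5}B_9,\ \hat E_{10}=E_{10}-A_8A_5^\dagger E_7B_8-A_9E_8B_5^\dagger B_9,\ M_{22}=R_{\hat A_8}A_9,\ N_{22}=\hat B_9L_{B_8},\ S_{22}=A_9L_{M_{22}},\\ &\hat A_5=M_{22}H_3,\ \hat C_5=M_{22}H_4,\ \hat B_5=J_3B_8L_{\hat B_9},\ \hat D_5=J_4B_8L_{\hat B_9},\ \hat Q=R_{\hat A_8}\hat E_{10}L_{\hat B_9},\\ &C_6=\hat C_4L_{A_3},\ D_6=R_{B_3}\hat D_4,\ C_7=\hat C_5L_{A_3},\ D_7=R_{B_3}\hat D_5,\\ &G=\hat P-\hat C_4A_3^\dagger E_3\hat D_4-\hat C_4L_{A_3}E_4B_3^\dagger\hat D_4,\quad F=\hat Q-\hat C_5A_3^\dagger E_3\hat D_5-\hat C_5L_{A_3}E_4B_3^\dagger\hat D_5,\\ &M_1=R_{\hat A_4}C_6,\ N_1=D_6L_{\hat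 B_4},\ S_1=C_6L_{M_1},\ M_2=R_{\hat A_5}C_7,\ N_2=D_7L_{\hat B_5},\ S_2=C_7L_{M_2},\\ &A_{11}=(L_{M_1}L_{S_1}\ \ L_{M_2}L_{S_2}),\ B_{11}=\tbinom{R_{D_6}}{R_{D_7}},\ E_{11}=M_2^\dagger FD_7^\dagger+S_2^\dagger S_2C_7^\dagger FN_2^\dagger-M_1^\dagger GD_6^\dagger-S_1^\dagger S_1C_6^\dagger GN_1^\dagger,\\ &\mathcal A=R_{A_{11}}L_{M_1},\ \mathcal B=R_{N_1}L_{B_{11}},\ \mathcal C=R_{A_{11}}L_{M_2},\ \mathcal D=R_{N_2}L_{B_{11}},\ \mathcal E=R_{A_{11}}E_{11}L_{B_{11}},\ \mathcal M=R_{\mathcal A}\mathcal C,\ \mathcal N=\mathcal DL_{\mathcal B},\ \mathcal S=\mathcal CL_{\mathcal M},\\ &A_{22}=(L_{A_1}\ \ L_{\hat A_4}),\ B_{22}=\tbinom{R_{B_1}}{R_{\hat B_4}},\ C_{22}=\hat A_4^\dagger S_1,\ D_{22}=R_{N_1}D_6\hat B_4^\dagger,\\ &E_{22}=\hat A_4^\dagger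 G\hat B_4^\dagger-A_1^\dagger E_1B_1^\dagger-\hat A_4^\dagger S_1C_6^\dagger GN_1^\dagger D_6\hat B_4^\dagger-\hat A_4^\dagger C_6M_1^\dagger G\hat B_4^\dagger,\\ &A_{33}=R_{A_{22}}C_{22},\ B_{33}=D_{22}L_{B_{22}},\ E_{33}=R_{A_{22}}E_{22}L_{B_{22}},\\ &A_{44}=(L_{A_2}\ \ L_{\hat A_5}),\ B_{44}=\tbinom{R_{B_2}}{R_{\hat B_5}},\ C_{44}=-\hat A_5^\dagger S_2,\ D_{44}=R_{N_2}D_7\hat B_5^\dagger,\\ &E_{44}=\hat A_5^\dagger F\hat B_5^\dagger-A_2^\dagger E_2B_2^\dagger-\hat A_5^\dagger S_2C_7^\dagger FN_2^\dagger D_7\hat B_5^\dagger-\hat A_5^\dagger C_7M_2^\dagger F\hat B_5^\dagger,\\ &A_{55}=R_{A_{44}}C_{44},\ B_{55}=D_{44}L_{B_{44}},\ E_{55}=R_{A_{44}}E_{44}L_{B_{44}},\\ &A_{66}=(L_{\mathcal A}\ \ L_{A_{33}}),\ B_{66}=\tbinom{R_{\mathcal B}}{R_{B_{33}}},\ C_{66}=-\mathcal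 A^\dagger\mathcal S,\ D_{66}=R_{\mathcal N}\mathcal D\mathcal B^\dagger,\\ &E_{66}=A_{33}^\dagger E_{33}B_{33}^\dagger-\mathcal A^\dagger\mathcal E\mathcal B^\dagger+\mathcal A^\dagger\mathcal S\mathcal C^\dagger\mathcal E\mathcal N^\dagger\mathcal D\mathcal B^\dagger+\mathcal A^\dagger\mathcal C\mathcal M^\dagger\mathcal E\mathcal B^\dagger,\\ &A_{77}=R_{A_{66}}C_{66},\ B_{77}=D_{66}L_{B_{66}},\ E_{77}=R_{A_{66}}E_{66}L_{B_{66}},\\ &A_{88}=(L_{\mathcal M}L_{\mathcal S}\ \ L_{A_{55}}),\ B_{88}=\tbinom{R_{\mathcal D}}{R_{B_{55}}},\ C_{88}=L_{\mathcal M},\ D_{88}=R_{\mathcal N},\\ &E_{88}=A_{55}^\dagger E_{55}B_{55}^\dagger-\mathcal M^\dagger\mathcal E\mathcal D^\dagger-\mathcal S^\dagger\mathcal S\mathcal C^\dagger\mathcal E\mathcal N^\dagger,\\ &A_{99}=R_{A_{88}}C_{88},\ B_{99}=D_{88}L_{B_{88}},\ E_{99}=R_{A_{88}}E_{88}L_{B_{88}},\\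 &\tilde A=(L_{A_{77}}\ \ -L_{A_{99}}),\ \tilde B=\tbinom{R_{B_{77}}}{-R_{B_{99}}},\ \tilde E=A_{77}^\dagger E_{77}B_{77}^\dagger-A_{99}^\dagger E_{99}B_{99}^\dagger. \end{aligned}$$ **Theorem.** (a) The system $(*)$ is solvable if and only if all of the following hold: $$\begin{aligned} &R_{A_4}E_5=0,\ E_6L_{B_4}=0,\ R_{A_5}E_7=0,\ E_8L_{B_5}=0,\\ &R_{M_{11}}R_{\hat A_6}\hat E_9=0,\ \hat E_9L_{B_6}L_{N_{11}}=0,\ R_{A_7}\hat E_9L_{B_6}=0,\ R_{M_{22}}R_{\hat A_8}\hat E_{10}=0,\ \hat E_{10}L_{B_8}L_{N_{22}}=0,\ R_{A_9}\hat E_{10}L_{B_8}=0,\\ &R_{A_3}E_3=0,\ E_4L_{B_3}=0,\ A_3E_4=E_3B_3,\\ &R_{\hat A_4}GL_{D_6}=0,\ R_{C_6}GL_{\hat B_4}=0,\ R_{M_1}R_{\hat A_4}G=0,\ GL_{\hat B_4}L_{N_1}=0,\\ &R_{\hat A_5}FL_{D_7}=0,\ R_{C_7}FL_{\hat B_5}=0,\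 R_{M_2}R_{\hat A_5}F=0,\ FL_{\hat B_5}L_{N_2}=0,\\ &R_{\mathcal M}R_{\mathcal A}\mathcal E=0,\ R_{\mathcal A}\mathcal EL_{\mathcal D}=0,\ \mathcal EL_{\mathcal B}L_{\mathcal N}=0,\ R_{\mathcal C}\mathcal EL_{\mathcal B}=0,\\ &R_{A_1}E_1=0,\ E_1L_{B_1}=0,\ R_{A_2}E_2=0,\ E_2L_{B_2}=0,\\ &R_{A_{jj}}E_{jj}=0,\ E_{jj}L_{B_{jj}}=0\quad(jj=33,55,77,99),\qquad R_{\tilde A}\tilde EL_{\tilde B}=0. \end{aligned}$$ (b) If these conditions hold, then $(X_1,X_2,Y_1,Y_2,X_3,Y_3,W)$ is a solution of $(*)$ if and only if it has the form $$\begin{aligned} &X_1=A_4^\dagger E_5+L_{A_4}V_{11},\quad X_2=E_6B_4^\dagger+V_{22}R_{B_4},\quad Y_1=A_5^\dagger E_7+L_{A_5}V_{33},\quad Y_2=E_8B_5^\dagger+V_{44}R_{B_5},\\ &X_3=A_1^\dagger E_1B_1^\dagger+L_{A_1}U_1+U_2R_{B_1},\quad Y_3=A_2^\dagger E_2B_2^\dagger+L_{A_2}U_3+U_4R_{B_2},\\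 &W=A_3^\dagger E_3+L_{A_3}E_4B_3^\dagger+L_{A_3}U_5R_{B_3}, \end{aligned}$$ where $$\begin{aligned} &\grave E_1=\hat E_9-A_7(C_3X_3D_3+C_4WD_4)B_6,\qquad \grave E_2=\hat E_{10}-A_9(H_3Y_3J_3+H_4WJ_4)B_8,\\ &V_{11}=\hat A_6^\dagger\grave E_1B_6^\dagger-\hat A_6^\dagger A_7M_{11}^\dagger\grave E_1B_6^\dagger-\hat A_6^\dagger S_{11}A_7^\dagger\grave E_1N_{11}^\dagger\hat B_7B_6^\dagger-\hat A_6^\dagger S_{11}T_{21}R_{N_{11}}\hat B_7B_6^\dagger+L_{\hat A_6}T_{41}+T_{51}R_{B_6},\\ &V_{22}=M_{11}^\dagger\grave E_1\hat B_7^\dagger+S_{11}^\dagger S_{11}A_7^\dagger\grave E_1N_{11}^\dagger+L_{M_{11}}L_{S_{11}}T_{11}+L_{M_{11}}T_{21}R_{N_{11}}+T_{31}R_{\hat B_7},\\ &V_{33}=\hat A_8^\dagger\grave E_2B_8^\dagger-\hat A_8^\dagger A_9M_{22}^\dagger\grave E_2B_8^\dagger-\hat A_8^\dagger S_{22}A_9^\dagger\grave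 E_2N_{22}^\dagger\hat B_9B_8^\dagger-\hat A_8^\dagger S_{22}J_{21}R_{N_{22}}\hat B_9B_8^\dagger+L_{\hat A_8}J_{41}+J_{51}R_{B_8},\\ &V_{44}=M_{22}^\dagger\grave E_2\hat B_9^\dagger+S_{22}^\dagger S_{22}A_9^\dagger\grave E_2N_{22}^\dagger+L_{M_{22}}L_{S_{22}}J_{11}+L_{M_{22}}J_{21}R_{N_{22}}+J_{31}R_{\hat B_9},\\ &U_1=(\mathcal I\ \ 0)\big(A_{22}^\dagger(E_{22}-C_{22}V_2D_{22})-A_{22}^\dagger H_{12}B_{22}+L_{A_{22}}H_{11}\big),\\ &U_2=\big(R_{A_{22}}(E_{22}-C_{22}V_2D_{22})B_{22}^\dagger+A_{22}A_{22}^\dagger H_{12}+H_{13}R_{B_{22}}\big)\tbinom{\mathcal I}{0},\\ &U_3=(\mathcal I\ \ 0)\big(A_{44}^\dagger(E_{44}-C_{44}T_2D_{44})-A_{44}^\dagger H_{22}B_{44}+L_{A_{44}}H_{21}\big),\\ &U_4=\big(R_{A_{44}}(E_{44}-C_{44}T_2D_{44})B_{44}^\dagger+A_{44}A_{44}^\dagger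 H_{22}+H_{23}R_{B_{44}}\big)\tbinom{\mathcal I}{0},\\ &U_5=M_1^\dagger GD_6^\dagger+S_1^\dagger S_1C_6^\dagger GN_1^\dagger+L_{M_1}L_{S_1}V_1+L_{M_1}V_2R_{N_1}+V_3R_{D_6},\\ &V_1=(\mathcal I\ \ 0)\big(A_{11}^\dagger(E_{11}-L_{M_1}V_2R_{N_1}-L_{M_2}T_2R_{N_2})+W_1B_{11}+L_{A_{11}}W_2\big),\\ &V_3=\big(R_{A_{11}}(E_{11}-L_{M_1}V_2R_{N_1}-L_{M_2}T_2R_{N_2})B_{11}^\dagger-A_{11}W_1-W_3R_{B_{11}}\big)\tbinom{\mathcal I}{0},\\ &V_2=\mathcal A^\dagger\mathcal E\mathcal B^\dagger-\mathcal A^\dagger\mathcal S\mathcal C^\dagger\mathcal E\mathcal N^\dagger\mathcal D\mathcal B^\dagger-\mathcal A^\dagger\mathcal C\mathcal M^\dagger\mathcal E\mathcal B^\dagger-\mathcal A^\dagger\mathcal SW_4R_{\mathcal N}\mathcal D\mathcal B^\dagger+L_{\mathcal A}W_5+W_6R_{\mathcal B},\\ &T_2=\mathcal M^\dagger\mathcal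 E\mathcal D^\dagger+\mathcal S^\dagger\mathcal S\mathcal C^\dagger\mathcal E\mathcal N^\dagger+L_{\mathcal M}L_{\mathcal S}W_7+L_{\mathcal M}W_4R_{\mathcal N}+W_8R_{\mathcal D},\\ &W_4=A_{77}^\dagger E_{77}B_{77}^\dagger-L_{A_{77}}Q_1-Q_2R_{B_{77}},\\ &W_5=(\mathcal I\ \ 0)\big(A_{66}^\dagger(E_{66}-C_{66}W_4D_{66})-A_{66}^\dagger H_{32}B_{66}+L_{A_{66}}H_{31}\big),\\ &W_6=\big(R_{A_{66}}(E_{66}-C_{66}W_4D_{66})B_{66}^\dagger+A_{66}A_{66}^\dagger H_{32}+H_{33}R_{B_{66}}\big)\tbinom{\mathcal I}{0},\\ &W_7=(\mathcal I\ \ 0)\big(A_{88}^\dagger(E_{88}-C_{88}W_4D_{88})-A_{88}^\dagger H_{42}B_{88}+L_{A_{88}}H_{41}\big),\\ &W_8=\big(R_{A_{88}}(E_{88}-C_{88}W_4D_{88})B_{88}^\dagger+A_{88}A_{88}^\dagger H_{42}+H_{43}R_{B_{88}}\big)\tbinom{\mathcal I}{0},\\ &Q_1=(\mathcal I\ \ 0)\big(\tilde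 A^\dagger\tilde E-\tilde A^\dagger K_2\tilde B+L_{\tilde A}K_1\big),\qquad Q_2=\big(R_{\tilde A}\tilde E\tilde B^\dagger+\tilde A\tilde A^\dagger K_2+K_3R_{\tilde B}\big)\tbinom{\mathcal I}{0}, \end{aligned}$$ for some quaternion tensors $W_i$, $K_i$, $H_{ji}$, $T_{l1}$, $J_{l1}$ $(i=1,2,3;\ j=1,\dots,4;\ l=1,\dots,5)$ of the formats that make these expressions meaningful. -/

import Mathlib

open scoped Quaternion Matrix

set_option linter.unusedSectionVars false

noncomputable section

namespace QTensor

/-! ### Quaternion tensors and the Einstein product -/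

/-- Multi-indices `(i₁, …, i_N)`, where `i_s` takes `I_s` values. -/
abbrev MultiIndex {N : ℕ} (I : Fin N → ℕ) : Type := (s : Fin N) → Fin (I s)

/-- The tensors in `ℍ^{I(N) × J(M)}`: arrays of quaternions indexed by a pair of multi-indices.
The product `A * B` is the Einstein product, which sums over the whole inner multi-index (see
`einstein_apply`); `Aᴴ` is the conjugate transpose and `1` is the unit tensor. -/
abbrev Tensor {N M : ℕ} (I : Fin N → ℕ) (J : Fin M → ℕ) : Type :=
  Matrix (MultiIndex I) (MultiIndex J) ℍ[ℝ]

theorem einstein_apply {N M K : ℕ} {I : Fin N → ℕ} {J : Fin M → ℕ} {L : Fin K → ℕ}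
    (A : Tensor I J) (B : Tensor J L) (i : MultiIndex I) (l : MultiIndex L) :
    (A * B) i l = ∑ j : MultiIndex J, A i j * B j l :=
  Matrix.mul_apply

/-! ### The Moore–Penrose inverse -/

theorem linearMap_exists_inner_inverse {K V W : Type*} [DivisionRing K] [AddCommGroup V]
    [Module K V] [AddCommGroup W] [Module K W] (f : V →ₗ[K] W) :
    ∃ g : W →ₗ[K] V, f ∘ₗ g ∘ₗ f = f := by
  obtain ⟨s, hs⟩ := LinearMap.exists_rightInverse_of_surjective f.rangeRestrict
    (LinearMap.range_rangeRestrict f)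
  obtain ⟨g, hg⟩ := s.exists_extend
  refine ⟨g, LinearMap.ext fun x => ?_⟩
  have h1 : g (f x) = s (f.rangeRestrict x) := LinearMap.congr_fun hg (f.rangeRestrict x)
  have h2 : f.rangeRestrict (s (f.rangeRestrict x)) = f.rangeRestrict x :=
    LinearMap.congr_fun hs _
  have h3 : f (s (f.rangeRestrict x)) = f x := congrArg Subtype.val h2
  rw [LinearMap.comp_apply, LinearMap.comp_apply, h1, h3]

section MoorePenrose

variable {m n : Type} [Fintype m] [Fintype n]

/-- The four Penrose equations: `X` is the Moore–Penrose inverse of `A`. -/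
structure IsMoorePenrose (A : Matrix m n ℍ[ℝ]) (X : Matrix n m ℍ[ℝ]) : Prop where
  mul_mul_self : A * X * A = A
  mul_mul_inv : X * A * X = X
  left_hermitian : (A * X)ᴴ = A * X
  right_hermitian : (X * A)ᴴ = X * A

theorem IsMoorePenrose.unique {A : Matrix m n ℍ[ℝ]} {X Y : Matrix n m ℍ[ℝ]}
    (hX : IsMoorePenrose A X) (hY : IsMoorePenrose A Y) : X = Y := by
  have h1 : A * X = A * Y := by
    have h : A * X = A * Y * (A * X) := by
      rw [← Matrix.mul_assoc, hY.mul_mul_self]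
    rw [← hX.left_hermitian, h, Matrix.conjTranspose_mul, hX.left_hermitian,
      hY.left_hermitian, ← Matrix.mul_assoc, hX.mul_mul_self]
  have h2 : X * A = Y * A := by
    have h : X * A = X * A * (Y * A) := by
      rw [Matrix.mul_assoc, ← Matrix.mul_assoc A, hY.mul_mul_self]
    rw [← hX.right_hermitian, h, Matrix.conjTranspose_mul, hX.right_hermitian,
      hY.right_hermitian, Matrix.mul_assoc, ← Matrix.mul_assoc A, hX.mul_mul_self]
  rw [← hX.mul_mul_inv, Matrix.mul_assoc, h1, ← Matrix.mul_assoc, h2, hY.mul_mul_inv]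

theorem eq_zero_of_conjTranspose_mul_self {A : Matrix m n ℍ[ℝ]} (h : Aᴴ * A = 0) : A = 0 := by
  ext1 i j
  have hj := congrFun (congrFun h j) j
  simp only [Matrix.mul_apply, Matrix.conjTranspose_apply, Quaternion.star_mul_self,
    Matrix.zero_apply] at hj
  have h0 : ∑ i, Quaternion.normSq (A i j) = 0 := by
    have h1 : ((∑ i, Quaternion.normSq (A i j) : ℝ) : ℍ[ℝ]) = 0 := by
      rw [← hj]
      exact map_sum (algebraMap ℝ ℍ[ℝ]) _ _
    simpa using congrArg QuaternionAlgebra.re h1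
  rw [Finset.sum_eq_zero_iff_of_nonneg fun _ _ => Quaternion.normSq_nonneg] at h0
  exact Quaternion.normSq_eq_zero.1 (h0 i (Finset.mem_univ i))

variable [DecidableEq m] [DecidableEq n]

theorem exists_inner_inverse (A : Matrix m n ℍ[ℝ]) : ∃ G : Matrix n m ℍ[ℝ], A * G * A = A := by
  obtain ⟨g, hg⟩ := linearMap_exists_inner_inverse (Matrix.toLinearMapRight' A)
  refine ⟨Matrix.toLinearMapRight'.symm g, Matrix.toLinearMapRight'.injective ?_⟩
  rw [Matrix.toLinearMapRight'_mul, Matrix.toLinearMapRight'_mul, LinearEquiv.apply_symm_apply]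
  exact hg

theorem exists_hermitian_inner_inverse (A : Matrix m n ℍ[ℝ]) :
    ∃ X : Matrix n m ℍ[ℝ], A * X * A = A ∧ (A * X)ᴴ = A * X := by
  obtain ⟨G, hG⟩ := exists_inner_inverse (Aᴴ * A)
  have h1 : A * (G * Aᴴ) * A = A := by
    rw [← sub_eq_zero]
    apply eq_zero_of_conjTranspose_mul_self
    have h2 : A * (G * Aᴴ) * A - A = A * (G * Aᴴ * A - 1) := by
      simp only [Matrix.mul_sub, Matrix.mul_assoc, Matrix.mul_one]
    have h3 : Aᴴ * (A * (G * Aᴴ) * A - A) = 0 := by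
      rw [Matrix.mul_sub, sub_eq_zero]
      simpa only [Matrix.mul_assoc] using hG
    calc _ = (A * (G * Aᴴ * A - 1))ᴴ * (A * (G * Aᴴ) * A - A) := by rw [h2]
      _ = 0 := by rw [Matrix.conjTranspose_mul, Matrix.mul_assoc, h3, Matrix.mul_zero]
  refine ⟨G * Aᴴ, h1, ?_⟩
  have h4 : A * (G * Aᴴ) = A * (G * Aᴴ) * (A * (G * Aᴴ))ᴴ := by
    have h5 : Aᴴ * (A * (G * Aᴴ))ᴴ = Aᴴ := by
      rw [← Matrix.conjTranspose_mul, h1]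
    rw [Matrix.mul_assoc A, Matrix.mul_assoc G, h5]
  rw [h4, Matrix.conjTranspose_mul, Matrix.conjTranspose_conjTranspose]

theorem exists_isMoorePenrose (A : Matrix m n ℍ[ℝ]) : ∃ X, IsMoorePenrose A X := by
  obtain ⟨X, hX, hX'⟩ := exists_hermitian_inner_inverse A
  obtain ⟨Y, hY, hY'⟩ := exists_hermitian_inner_inverse Aᴴ
  have h1 : A * Yᴴ * A = A := by
    have := congrArg Matrix.conjTranspose hY
    simpa [Matrix.conjTranspose_mul, Matrix.mul_assoc] using this
  have h2 : (Yᴴ * A)ᴴ = Yᴴ * A := by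
    rw [Matrix.conjTranspose_mul, Matrix.conjTranspose_conjTranspose, ← hY',
      Matrix.conjTranspose_mul, Matrix.conjTranspose_conjTranspose]
  have h3 : A * (Yᴴ * A * X) = A * X := by
    rw [← Matrix.mul_assoc, ← Matrix.mul_assoc, h1]
  have h4 : Yᴴ * A * X * A = Yᴴ * A := by
    rw [Matrix.mul_assoc, Matrix.mul_assoc, ← Matrix.mul_assoc A, hX]
  refine ⟨Yᴴ * A * X, ?_, ?_, ?_, ?_⟩
  · rw [h3, hX]
  · rw [h4, ← Matrix.mul_assoc, ← Matrix.mul_assoc, Matrix.mul_assoc Yᴴ A, Matrix.mul_assoc Yᴴ (A * Yᴴ), h1]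
  · rw [h3, hX']
  · rw [h4, h2]

/-- The Moore–Penrose inverse `A†`: the matrix satisfying the four Penrose equations, which exists
by `exists_isMoorePenrose` and is unique by `IsMoorePenrose.unique`. -/
def pinv (A : Matrix m n ℍ[ℝ]) : Matrix n m ℍ[ℝ] :=
  Classical.choose (exists_isMoorePenrose A)

theorem isMoorePenrose_pinv (A : Matrix m n ℍ[ℝ]) : IsMoorePenrose A (pinv A) :=
  Classical.choose_spec (exists_isMoorePenrose A)

end MoorePenrose

postfix:max "†" => pinv

section Blocks

variable {N M : ℕ} {I : Fin N → ℕ} {J K : Fin M → ℕ}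

/-- The projector `R_A = I - A * A†`. -/
def projR (A : Tensor I J) : Tensor I I := 1 - A * A†

/-- The projector `L_A = I - A† * A`. -/
def projL (A : Tensor I J) : Tensor J J := 1 - A† * A

/-- The row block tensor `(A B)`, whose column multi-indices `l` have `0 ≤ l_s < J_s + K_s`: it is
`A` where all `l_s < J_s`, it is `B` (shifted) where all `l_s ≥ J_s`, and it is `0` elsewhere. -/
def rowBlock (A : Tensor I J) (B : Tensor I K) : Tensor I (fun s => J s + K s) := fun i l =>
  if h : ∀ s, (l s : ℕ) < J s then A i (fun s => ⟨l s, h s⟩)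
  else if h : ∀ s, J s ≤ (l s : ℕ) then
    B i (fun s => ⟨l s - J s, by
      have h1 := h s
      have h2 : (l s : ℕ) < J s + K s := (l s).isLt
      omega⟩)
  else 0

/-- The column block tensor of `C` (on top) and `D` (below), with the same convention as
`rowBlock` for the row multi-indices. -/
def colBlock (C : Tensor J I) (D : Tensor K I) : Tensor (fun s => J s + K s) I := fun l i =>
  if h : ∀ s, (l s : ℕ) < J s then C (fun s => ⟨l s, h s⟩) i
  else if h : ∀ s, J s ≤ (l s : ℕ) then
    D (fun s => ⟨l s - J s, by
      have h1 := h s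
      have h2 : (l s : ℕ) < J s + K s := (l s).isLt
      omega⟩) i
  else 0

/-- The format of a block of two tensors of format `I`. -/
abbrev dbl (I : Fin N → ℕ) : Fin N → ℕ := fun s => I s + I s

/-- The row block `(I 0)` of a unit tensor and a zero tensor. -/
def selRow (I : Fin N → ℕ) : Tensor I (dbl I) := rowBlock (1 : Tensor I I) (0 : Tensor I I)

/-- The column block of a unit tensor on top of a zero tensor. -/
def selCol (I : Fin N → ℕ) : Tensor (dbl I) I := colBlock (1 : Tensor I I) (0 : Tensor I I)

end Blocks

/-! ### The system -/

/-- The formats of the tensors in the system: left-hand formats have `N` modes and right-hand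
formats have `M` modes. -/
structure Dims (N M : ℕ) where
  (I J Q P A E C V G : Fin N → ℕ)
  (L K S T H B U D F R : Fin M → ℕ)

/-- The given coefficient tensors and right-hand sides; they are arbitrary. -/
structure SystemData {N M : ℕ} (δ : Dims N M) where
  A1 : Tensor δ.I δ.J
  A2 : Tensor δ.I δ.Q
  A3 : Tensor δ.I δ.P
  A4 : Tensor δ.A δ.E
  A5 : Tensor δ.C δ.V
  A6 : Tensor δ.A δ.E
  A7 : Tensor δ.A δ.G
  A8 : Tensor δ.C δ.V
  A9 : Tensor δ.C δ.G
  B1 : Tensor δ.L δ.K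
  B2 : Tensor δ.S δ.K
  B3 : Tensor δ.T δ.K
  B4 : Tensor δ.H δ.B
  B5 : Tensor δ.U δ.D
  B6 : Tensor δ.F δ.B
  B7 : Tensor δ.H δ.B
  B8 : Tensor δ.D δ.R
  B9 : Tensor δ.U δ.R
  C3 : Tensor δ.G δ.J
  C4 : Tensor δ.G δ.P
  D3 : Tensor δ.L δ.F
  D4 : Tensor δ.T δ.F
  H3 : Tensor δ.G δ.Q
  H4 : Tensor δ.G δ.P
  J3 : Tensor δ.S δ.D
  J4 : Tensor δ.T δ.D
  E1 : Tensor δ.I δ.K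
  E2 : Tensor δ.I δ.K
  E3 : Tensor δ.I δ.T
  E4 : Tensor δ.P δ.K
  E5 : Tensor δ.A δ.F
  E6 : Tensor δ.G δ.B
  E7 : Tensor δ.C δ.D
  E8 : Tensor δ.G δ.D
  E9 : Tensor δ.A δ.B
  E10 : Tensor δ.C δ.R

/-- A value of the seven unknowns. -/
structure Unknowns {N M : ℕ} (δ : Dims N M) where
  X1 : Tensor δ.E δ.F
  X2 : Tensor δ.G δ.H
  Y1 : Tensor δ.V δ.D
  Y2 : Tensor δ.G δ.U
  X3 : Tensor δ.J δ.L
  Y3 : Tensor δ.Q δ.S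
  W : Tensor δ.P δ.T

/-- The free tensor parameters of the general solution. -/
structure Params {N M : ℕ} (δ : Dims N M) where
  (T11 T21 T31 : Tensor δ.G δ.H)
  (T41 T51 : Tensor δ.E δ.F)
  (J11 J21 J31 : Tensor δ.G δ.U)
  (J41 J51 : Tensor δ.V δ.D)
  H11 : Tensor (dbl δ.J) δ.L
  (H12 H13 : Tensor δ.J (dbl δ.L))
  H21 : Tensor (dbl δ.Q) δ.S
  (H22 H23 : Tensor δ.Q (dbl δ.S))
  (H31 H41 K1 W2 : Tensor (dbl δ.P) δ.T)
  (H32 H33 H42 H43 K2 K3 W3 : Tensor δ.P (dbl δ.T))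
  W1 : Tensor (dbl δ.P) (dbl δ.T)

namespace SystemData

variable {N M : ℕ} {δ : Dims N M} (d : SystemData δ)

/-- The system of ten tensor equations. -/
structure IsSolution (u : Unknowns δ) : Prop where
  eq1 : d.A1 * u.X3 * d.B1 = d.E1
  eq2 : d.A2 * u.Y3 * d.B2 = d.E2
  eq3 : d.A4 * u.X1 = d.E5
  eq4 : u.X2 * d.B4 = d.E6
  eq5 : d.A5 * u.Y1 = d.E7
  eq6 : u.Y2 * d.B5 = d.E8
  eq7 : d.A3 * u.W = d.E3
  eq8 : u.W * d.B3 = d.E4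
  eq9 : d.A6 * u.X1 * d.B6 + d.A7 * u.X2 * d.B7
    + d.A7 * (d.C3 * u.X3 * d.D3 + d.C4 * u.W * d.D4) * d.B6 = d.E9
  eq10 : d.A8 * u.Y1 * d.B8 + d.A9 * u.Y2 * d.B9
    + d.A9 * (d.H3 * u.Y3 * d.J3 + d.H4 * u.W * d.J4) * d.B8 = d.E10

/-! ### The derived tensors

A letter `h` in a name stands for a hat, a letter `t` for a tilde and a letter `g` for a grave
accent; the index `0` marks the tensors that are denoted by a bare letter. -/

def Ah6 : Tensor δ.A δ.E := d.A6 * projL d.A4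

def Bh7 : Tensor δ.H δ.B := projR d.B4 * d.B7

def Eh9 : Tensor δ.A δ.B := d.E9 - d.A6 * d.A4† * d.E5 * d.B6 - d.A7 * d.E6 * d.B4† * d.B7

def M11 : Tensor δ.A δ.G := projR d.Ah6 * d.A7

def N11 : Tensor δ.H δ.B := d.Bh7 * projL d.B6

def S11 : Tensor δ.A δ.G := d.A7 * projL d.M11

def Ah4 : Tensor δ.A δ.J := d.M11 * d.C3

def Ch4 : Tensor δ.A δ.P := d.M11 * d.C4

def Bh4 : Tensor δ.L δ.B := d.D3 * d.B6 * projL d.Bh7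

def Dh4 : Tensor δ.T δ.B := d.D4 * d.B6 * projL d.Bh7

def Ph : Tensor δ.A δ.B := projR d.Ah6 * d.Eh9 * projL d.Bh7

def Ah8 : Tensor δ.C δ.V := d.A8 * projL d.A5

def Bh9 : Tensor δ.U δ.R := projR d.B5 * d.B9

def Eh10 : Tensor δ.C δ.R := d.E10 - d.A8 * d.A5† * d.E7 * d.B8 - d.A9 * d.E8 * d.B5† * d.B9

def M22 : Tensor δ.C δ.G := projR d.Ah8 * d.A9

def N22 : Tensor δ.U δ.R := d.Bh9 * projL d.B8

def S22 : Tensor δ.C δ.G := d.A9 * projL d.M22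

def Ah5 : Tensor δ.C δ.Q := d.M22 * d.H3

def Ch5 : Tensor δ.C δ.P := d.M22 * d.H4

def Bh5 : Tensor δ.S δ.R := d.J3 * d.B8 * projL d.Bh9

def Dh5 : Tensor δ.T δ.R := d.J4 * d.B8 * projL d.Bh9

def Qh : Tensor δ.C δ.R := projR d.Ah8 * d.Eh10 * projL d.Bh9

def C6 : Tensor δ.A δ.P := d.Ch4 * projL d.A3

def D6 : Tensor δ.T δ.B := projR d.B3 * d.Dh4

def C7 : Tensor δ.C δ.P := d.Ch5 * projL d.A3

def D7 : Tensor δ.T δ.R := projR d.B3 * d.Dh5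

def G : Tensor δ.A δ.B :=
  d.Ph - d.Ch4 * d.A3† * d.E3 * d.Dh4 - d.Ch4 * projL d.A3 * d.E4 * d.B3† * d.Dh4

def F : Tensor δ.C δ.R :=
  d.Qh - d.Ch5 * d.A3† * d.E3 * d.Dh5 - d.Ch5 * projL d.A3 * d.E4 * d.B3† * d.Dh5

def M1 : Tensor δ.A δ.P := projR d.Ah4 * d.C6

def N1 : Tensor δ.T δ.B := d.D6 * projL d.Bh4

def S1 : Tensor δ.A δ.P := d.C6 * projL d.M1

def M2 : Tensor δ.C δ.P := projR d.Ah5 * d.C7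

def N2 : Tensor δ.T δ.R := d.D7 * projL d.Bh5

def S2 : Tensor δ.C δ.P := d.C7 * projL d.M2

def A11 : Tensor δ.P (dbl δ.P) := rowBlock (projL d.M1 * projL d.S1) (projL d.M2 * projL d.S2)

def B11 : Tensor (dbl δ.T) δ.T := colBlock (projR d.D6) (projR d.D7)

def E11 : Tensor δ.P δ.T :=
  d.M2† * d.F * d.D7† + d.S2† * d.S2 * d.C7† * d.F * d.N2†
    - d.M1† * d.G * d.D6† - d.S1† * d.S1 * d.C6† * d.G * d.N1†

def A0 : Tensor δ.P δ.P := projR d.A11 * projL d.M1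

def B0 : Tensor δ.T δ.T := projR d.N1 * projL d.B11

def C0 : Tensor δ.P δ.P := projR d.A11 * projL d.M2

def D0 : Tensor δ.T δ.T := projR d.N2 * projL d.B11

def E0 : Tensor δ.P δ.T := projR d.A11 * d.E11 * projL d.B11

def M0 : Tensor δ.P δ.P := projR d.A0 * d.C0

def N0 : Tensor δ.T δ.T := d.D0 * projL d.B0

def S0 : Tensor δ.P δ.P := d.C0 * projL d.M0

def A22 : Tensor δ.J (dbl δ.J) := rowBlock (projL d.A1) (projL d.Ah4)

def B22 : Tensor (dbl δ.L) δ.L := colBlock (projR d.B1) (projR d.Bh4)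

def C22 : Tensor δ.J δ.P := d.Ah4† * d.S1

def D22 : Tensor δ.T δ.L := projR d.N1 * d.D6 * d.Bh4†

def E22 : Tensor δ.J δ.L :=
  d.Ah4† * d.G * d.Bh4† - d.A1† * d.E1 * d.B1†
    - d.Ah4† * d.S1 * d.C6† * d.G * d.N1† * d.D6 * d.Bh4†
    - d.Ah4† * d.C6 * d.M1† * d.G * d.Bh4†

def A33 : Tensor δ.J δ.P := projR d.A22 * d.C22

def B33 : Tensor δ.T δ.L := d.D22 * projL d.B22

def E33 : Tensor δ.J δ.L := projR d.A22 * d.E22 * projL d.B22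

def A44 : Tensor δ.Q (dbl δ.Q) := rowBlock (projL d.A2) (projL d.Ah5)

def B44 : Tensor (dbl δ.S) δ.S := colBlock (projR d.B2) (projR d.Bh5)

def C44 : Tensor δ.Q δ.P := -(d.Ah5† * d.S2)

def D44 : Tensor δ.T δ.S := projR d.N2 * d.D7 * d.Bh5†

def E44 : Tensor δ.Q δ.S :=
  d.Ah5† * d.F * d.Bh5† - d.A2† * d.E2 * d.B2†
    - d.Ah5† * d.S2 * d.C7† * d.F * d.N2† * d.D7 * d.Bh5†
    - d.Ah5† * d.C7 * d.M2† * d.F * d.Bh5†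

def A55 : Tensor δ.Q δ.P := projR d.A44 * d.C44

def B55 : Tensor δ.T δ.S := d.D44 * projL d.B44

def E55 : Tensor δ.Q δ.S := projR d.A44 * d.E44 * projL d.B44

def A66 : Tensor δ.P (dbl δ.P) := rowBlock (projL d.A0) (projL d.A33)

def B66 : Tensor (dbl δ.T) δ.T := colBlock (projR d.B0) (projR d.B33)

def C66 : Tensor δ.P δ.P := -(d.A0† * d.S0)

def D66 : Tensor δ.T δ.T := projR d.N0 * d.D0 * d.B0†

def E66 : Tensor δ.P δ.T :=
  d.A33† * d.E33 * d.B33† - d.A0† * d.E0 * d.B0†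
    + d.A0† * d.S0 * d.C0† * d.E0 * d.N0† * d.D0 * d.B0†
    + d.A0† * d.C0 * d.M0† * d.E0 * d.B0†

def A77 : Tensor δ.P δ.P := projR d.A66 * d.C66

def B77 : Tensor δ.T δ.T := d.D66 * projL d.B66

def E77 : Tensor δ.P δ.T := projR d.A66 * d.E66 * projL d.B66

def A88 : Tensor δ.P (dbl δ.P) := rowBlock (projL d.M0 * projL d.S0) (projL d.A55)

def B88 : Tensor (dbl δ.T) δ.T := colBlock (projR d.D0) (projR d.B55)

def C88 : Tensor δ.P δ.P := projL d.M0

def D88 : Tensor δ.T δ.T := projR d.N0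

def E88 : Tensor δ.P δ.T :=
  d.A55† * d.E55 * d.B55† - d.M0† * d.E0 * d.D0†
    - d.S0† * d.S0 * d.C0† * d.E0 * d.N0†

def A99 : Tensor δ.P δ.P := projR d.A88 * d.C88

def B99 : Tensor δ.T δ.T := d.D88 * projL d.B88

def E99 : Tensor δ.P δ.T := projR d.A88 * d.E88 * projL d.B88

def At : Tensor δ.P (dbl δ.P) := rowBlock (projL d.A77) (-projL d.A99)

def Bt : Tensor (dbl δ.T) δ.T := colBlock (projR d.B77) (-projR d.B99)

def Et : Tensor δ.P δ.T := d.A77† * d.E77 * d.B77† - d.A99† * d.E99 * d.B99†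

/-- The solvability conditions. -/
structure SolvabilityConditions : Prop where
  c1 : projR d.A4 * d.E5 = 0
  c2 : d.E6 * projL d.B4 = 0
  c3 : projR d.A5 * d.E7 = 0
  c4 : d.E8 * projL d.B5 = 0
  c5 : projR d.M11 * projR d.Ah6 * d.Eh9 = 0
  c6 : d.Eh9 * projL d.B6 * projL d.N11 = 0
  c7 : projR d.A7 * d.Eh9 * projL d.B6 = 0
  c8 : projR d.M22 * projR d.Ah8 * d.Eh10 = 0
  c9 : d.Eh10 * projL d.B8 * projL d.N22 = 0
  c10 : projR d.A9 * d.Eh10 * projL d.B8 = 0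
  c11 : projR d.A3 * d.E3 = 0
  c12 : d.E4 * projL d.B3 = 0
  c13 : d.A3 * d.E4 = d.E3 * d.B3
  c14 : projR d.Ah4 * d.G * projL d.D6 = 0
  c15 : projR d.C6 * d.G * projL d.Bh4 = 0
  c16 : projR d.M1 * projR d.Ah4 * d.G = 0
  c17 : d.G * projL d.Bh4 * projL d.N1 = 0
  c18 : projR d.Ah5 * d.F * projL d.D7 = 0
  c19 : projR d.C7 * d.F * projL d.Bh5 = 0
  c20 : projR d.M2 * projR d.Ah5 * d.F = 0
  c21 : d.F * projL d.Bh5 * projL d.N2 = 0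
  c22 : projR d.M0 * projR d.A0 * d.E0 = 0
  c23 : projR d.A0 * d.E0 * projL d.D0 = 0
  c24 : d.E0 * projL d.B0 * projL d.N0 = 0
  c25 : projR d.C0 * d.E0 * projL d.B0 = 0
  c26 : projR d.A1 * d.E1 = 0
  c27 : d.E1 * projL d.B1 = 0
  c28 : projR d.A2 * d.E2 = 0
  c29 : d.E2 * projL d.B2 = 0
  c30 : projR d.A33 * d.E33 = 0
  c31 : d.E33 * projL d.B33 = 0
  c32 : projR d.A55 * d.E55 = 0
  c33 : d.E55 * projL d.B55 = 0
  c34 : projR d.A77 * d.E77 = 0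
  c35 : d.E77 * projL d.B77 = 0
  c36 : projR d.A99 * d.E99 = 0
  c37 : d.E99 * projL d.B99 = 0
  c38 : projR d.At * d.Et * projL d.Bt = 0

/-! ### The general solution -/

variable (p : Params δ)

def Q1 : Tensor δ.P δ.T :=
  selRow δ.P * (d.At† * d.Et - d.At† * p.K2 * d.Bt + projL d.At * p.K1)

def Q2 : Tensor δ.P δ.T :=
  (projR d.At * d.Et * d.Bt† + d.At * d.At† * p.K2 + p.K3 * projR d.Bt) * selCol δ.T

def W4 : Tensor δ.P δ.T :=
  d.A77† * d.E77 * d.B77† - projL d.A77 * d.Q1 p - d.Q2 p * projR d.B77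

def W5 : Tensor δ.P δ.T :=
  selRow δ.P * (d.A66† * (d.E66 - d.C66 * d.W4 p * d.D66) - d.A66† * p.H32 * d.B66
    + projL d.A66 * p.H31)

def W6 : Tensor δ.P δ.T :=
  (projR d.A66 * (d.E66 - d.C66 * d.W4 p * d.D66) * d.B66† + d.A66 * d.A66† * p.H32
    + p.H33 * projR d.B66) * selCol δ.T

def W7 : Tensor δ.P δ.T :=
  selRow δ.P * (d.A88† * (d.E88 - d.C88 * d.W4 p * d.D88) - d.A88† * p.H42 * d.B88
    + projL d.A88 * p.H41)

def W8 : Tensor δ.P δ.T :=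
  (projR d.A88 * (d.E88 - d.C88 * d.W4 p * d.D88) * d.B88† + d.A88 * d.A88† * p.H42
    + p.H43 * projR d.B88) * selCol δ.T

def V2 : Tensor δ.P δ.T :=
  d.A0† * d.E0 * d.B0† - d.A0† * d.S0 * d.C0† * d.E0 * d.N0† * d.D0 * d.B0†
    - d.A0† * d.C0 * d.M0† * d.E0 * d.B0†
    - d.A0† * d.S0 * d.W4 p * projR d.N0 * d.D0 * d.B0†
    + projL d.A0 * d.W5 p + d.W6 p * projR d.B0

def T2 : Tensor δ.P δ.T :=
  d.M0† * d.E0 * d.D0† + d.S0† * d.S0 * d.C0† * d.E0 * d.N0†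
    + projL d.M0 * projL d.S0 * d.W7 p + projL d.M0 * d.W4 p * projR d.N0
    + d.W8 p * projR d.D0

def V1 : Tensor δ.P δ.T :=
  selRow δ.P * (d.A11† * (d.E11 - projL d.M1 * d.V2 p * projR d.N1
      - projL d.M2 * d.T2 p * projR d.N2)
    + p.W1 * d.B11 + projL d.A11 * p.W2)

def V3 : Tensor δ.P δ.T :=
  (projR d.A11 * (d.E11 - projL d.M1 * d.V2 p * projR d.N1
      - projL d.M2 * d.T2 p * projR d.N2) * d.B11†
    - d.A11 * p.W1 - p.W3 * projR d.B11) * selCol δ.T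

def U1 : Tensor δ.J δ.L :=
  selRow δ.J * (d.A22† * (d.E22 - d.C22 * d.V2 p * d.D22) - d.A22† * p.H12 * d.B22
    + projL d.A22 * p.H11)

def U2 : Tensor δ.J δ.L :=
  (projR d.A22 * (d.E22 - d.C22 * d.V2 p * d.D22) * d.B22† + d.A22 * d.A22† * p.H12
    + p.H13 * projR d.B22) * selCol δ.L

def U3 : Tensor δ.Q δ.S :=
  selRow δ.Q * (d.A44† * (d.E44 - d.C44 * d.T2 p * d.D44) - d.A44† * p.H22 * d.B44
    + projL d.A44 * p.H21)

def U4 : Tensor δ.Q δ.S :=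
  (projR d.A44 * (d.E44 - d.C44 * d.T2 p * d.D44) * d.B44† + d.A44 * d.A44† * p.H22
    + p.H23 * projR d.B44) * selCol δ.S

def U5 : Tensor δ.P δ.T :=
  d.M1† * d.G * d.D6† + d.S1† * d.S1 * d.C6† * d.G * d.N1†
    + projL d.M1 * projL d.S1 * d.V1 p + projL d.M1 * d.V2 p * projR d.N1
    + d.V3 p * projR d.D6

def X3 : Tensor δ.J δ.L :=
  d.A1† * d.E1 * d.B1† + projL d.A1 * d.U1 p + d.U2 p * projR d.B1

def Y3 : Tensor δ.Q δ.S :=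
  d.A2† * d.E2 * d.B2† + projL d.A2 * d.U3 p + d.U4 p * projR d.B2

def W : Tensor δ.P δ.T :=
  d.A3† * d.E3 + projL d.A3 * d.E4 * d.B3† + projL d.A3 * d.U5 p * projR d.B3

def Eg1 : Tensor δ.A δ.B :=
  d.Eh9 - d.A7 * (d.C3 * d.X3 p * d.D3 + d.C4 * d.W p * d.D4) * d.B6

def Eg2 : Tensor δ.C δ.R :=
  d.Eh10 - d.A9 * (d.H3 * d.Y3 p * d.J3 + d.H4 * d.W p * d.J4) * d.B8

def V11 : Tensor δ.E δ.F :=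
  d.Ah6† * d.Eg1 p * d.B6† - d.Ah6† * d.A7 * d.M11† * d.Eg1 p * d.B6†
    - d.Ah6† * d.S11 * d.A7† * d.Eg1 p * d.N11† * d.Bh7 * d.B6†
    - d.Ah6† * d.S11 * p.T21 * projR d.N11 * d.Bh7 * d.B6†
    + projL d.Ah6 * p.T41 + p.T51 * projR d.B6

def V22 : Tensor δ.G δ.H :=
  d.M11† * d.Eg1 p * d.Bh7† + d.S11† * d.S11 * d.A7† * d.Eg1 p * d.N11†
    + projL d.M11 * projL d.S11 * p.T11 + projL d.M11 * p.T21 * projR d.N11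
    + p.T31 * projR d.Bh7

def V33 : Tensor δ.V δ.D :=
  d.Ah8† * d.Eg2 p * d.B8† - d.Ah8† * d.A9 * d.M22† * d.Eg2 p * d.B8†
    - d.Ah8† * d.S22 * d.A9† * d.Eg2 p * d.N22† * d.Bh9 * d.B8†
    - d.Ah8† * d.S22 * p.J21 * projR d.N22 * d.Bh9 * d.B8†
    + projL d.Ah8 * p.J41 + p.J51 * projR d.B8

def V44 : Tensor δ.G δ.U :=
  d.M22† * d.Eg2 p * d.Bh9† + d.S22† * d.S22 * d.A9† * d.Eg2 p * d.N22†
    + projL d.M22 * projL d.S22 * p.J11 + projL d.M22 * p.J21 * projR d.N22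
    + p.J31 * projR d.Bh9

/-- The values of the seven unknowns that belong to the free parameters `p`. -/
def generalSolution : Unknowns δ where
  X1 := d.A4† * d.E5 + projL d.A4 * d.V11 p
  X2 := d.E6 * d.B4† + d.V22 p * projR d.B4
  Y1 := d.A5† * d.E7 + projL d.A5 * d.V33 p
  Y2 := d.E8 * d.B5† + d.V44 p * projR d.B5
  X3 := d.X3 p
  Y3 := d.Y3 p
  W := d.W p

end SystemData

end QTensor

end

/-! Three linear equations carry the theorem. `A X B = E` is solvable iff `projR A * E = 0` and `E *
projL B = 0`, with the kernel directions `projL A * U + Z * projR B` free. `A X + Y B = E` is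
solvable iff `projR A * E * projL B = 0`. For `A X B + C Y D = E`, multiplying by `projR A` on the
left and by `projL B` on the right removes `X` and leaves two equations of the first kind for `Y`;
solving them in turn gives `Y`, then `X` (`TwoTermConditions.form_of_eq`,
`TwoTermConditions.eq_of_form`).

In the system, the one-sided equations leave a free parameter in each unknown they govern. The ninth
equation becomes a two-term equation for the parameters of `X1`, `X2`; of its four solvability
conditions only one involves `X3` and `W`, and it is again a two-term equation, with right-hand side
`G`. The tenth gives likewise an equation for `Y3`, `W` with right-hand side `F`.

Now `X3`, `Y3` and the parameter `U5` of `W` each have two general forms. Two forms describe the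
same tensor iff their difference vanishes. This is a block equation `A X + A' X' + Y B + Y' B' = E`,
an instance of `A X + Y B = E`, whose right-hand side contains the remaining parameters `V2`, `T2`.
Its solvability condition is therefore an equation for `V2` and `T2`. So `U5` yields a two-term
equation for both, `X3` a two-sided equation for `V2`, and `Y3` one for `T2`. Hence `V2` and `T2`
also have two forms each, sharing the parameter `W4`; matching them yields two two-sided equations
for `W4`, and matching the two forms of `W4` leaves a condition on the data alone. Each passage is
an equivalence once the data conditions met on the way are granted: read inwards it gives necessity
and the form of every solution, read outwards it gives sufficiency. -/

namespace QTensor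

section Calculus

variable {N₁ N₂ N₃ N₄ N₅ N₆ : ℕ} {I : Fin N₁ → ℕ} {J : Fin N₂ → ℕ} {K : Fin N₃ → ℕ}
  {L : Fin N₄ → ℕ} {P : Fin N₅ → ℕ} {Q : Fin N₆ → ℕ}

/-! ### Calculus of the projectors -/

theorem mul_pinv_mul (A : Tensor I J) : A * (A† * A) = A := by
  rw [← Matrix.mul_assoc, (isMoorePenrose_pinv A).mul_mul_self]

theorem pinv_mul_pinv (A : Tensor I J) : A† * (A * A†) = A† := by
  rw [← Matrix.mul_assoc, (isMoorePenrose_pinv A).mul_mul_inv]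

theorem projR_mul_self (A : Tensor I J) : projR A * A = 0 := by
  rw [projR, Matrix.sub_mul, Matrix.mul_assoc, mul_pinv_mul, Matrix.one_mul, sub_self]

theorem mul_projL_self (A : Tensor I J) : A * projL A = 0 := by
  rw [projL, Matrix.mul_sub, mul_pinv_mul, Matrix.mul_one, sub_self]

theorem conjTranspose_projR (A : Tensor I J) : (projR A)ᴴ = projR A := by
  rw [projR, Matrix.conjTranspose_sub, Matrix.conjTranspose_one,
    (isMoorePenrose_pinv A).left_hermitian]

theorem conjTranspose_projL (A : Tensor I J) : (projL A)ᴴ = projL A := by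
  rw [projL, Matrix.conjTranspose_sub, Matrix.conjTranspose_one,
    (isMoorePenrose_pinv A).right_hermitian]

theorem projR_mul_projR (A : Tensor I J) : projR A * projR A = projR A := by
  conv_lhs => rw [projR, Matrix.mul_sub, ← Matrix.mul_assoc, ← projR, projR_mul_self]
  rw [Matrix.zero_mul, Matrix.mul_one, sub_zero]

theorem projL_mul_projL (A : Tensor I J) : projL A * projL A = projL A := by
  conv_lhs => rw [projL, Matrix.sub_mul, Matrix.mul_assoc, ← projL, mul_projL_self]
  rw [Matrix.mul_zero, Matrix.one_mul, sub_zero]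

/-- The Moore–Penrose inverse absorbs every Hermitian left unit of the tensor. -/
theorem pinv_mul_of_mul_eq {A : Tensor I J} {S : Tensor I I} (hS : Sᴴ = S) (h : S * A = A) :
    A† * S = A† := by
  have h1 : A * A† * S = A * A† := by
    have h2 := (isMoorePenrose_pinv A).left_hermitian
    -- Both `A * A†` and `S` are Hermitian, so the adjoint turns right multiplication by `S` into
    -- left multiplication, which fixes `A`.
    calc A * A† * S = (S * A * A†)ᴴ := by
          rw [Matrix.mul_assoc S, Matrix.conjTranspose_mul, h2, hS]
      _ = A * A† := by rw [h, h2]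
  rw [← pinv_mul_pinv A, Matrix.mul_assoc, h1]

/-- The Moore–Penrose inverse absorbs every Hermitian right unit of the tensor. -/
theorem mul_pinv_of_mul_eq {A : Tensor I J} {S : Tensor J J} (hS : Sᴴ = S) (h : A * S = A) :
    S * A† = A† := by
  have h1 : S * (A† * A) = A† * A := by
    have h2 := (isMoorePenrose_pinv A).right_hermitian
    calc S * (A† * A) = (A† * (A * S))ᴴ := by
          rw [← Matrix.mul_assoc A†, Matrix.conjTranspose_mul, h2, hS]
      _ = A† * A := by rw [h, h2]
  rw [← pinv_mul_pinv A, ← Matrix.mul_assoc A†, ← Matrix.mul_assoc, h1]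

/-- The projector `projR A` is a Hermitian left unit of `projR A * C`. With its mirror image below,
this is what allows `M†`, `S†` and `N†` to stand in the solution formulas without the projectors
produced by the elimination. -/
theorem pinv_projR_mul (A : Tensor I J) (C : Tensor I K) :
    (projR A * C)† * projR A = (projR A * C)† :=
  pinv_mul_of_mul_eq (conjTranspose_projR A) (by rw [← Matrix.mul_assoc, projR_mul_projR])

theorem projL_mul_pinv_mul_projL (A : Tensor I J) (C : Tensor K J) :
    projL A * (C * projL A)† = (C * projL A)† :=
  mul_pinv_of_mul_eq (conjTranspose_projL A) (by rw [Matrix.mul_assoc, projL_mul_projL])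

theorem projR_mul_eq_zero_iff {A : Tensor I J} {E : Tensor I K} :
    projR A * E = 0 ↔ A * A† * E = E := by
  rw [projR, Matrix.sub_mul, Matrix.one_mul, sub_eq_zero, eq_comm]

theorem mul_projL_eq_zero_iff {A : Tensor I J} {E : Tensor K J} :
    E * projL A = 0 ↔ E * A† * A = E := by
  rw [projL, Matrix.mul_sub, Matrix.mul_one, sub_eq_zero, eq_comm, Matrix.mul_assoc]

theorem pinv_mul_add_projL_mul (A : Tensor I J) (X : Tensor J K) :
    A† * (A * X) + projL A * X = X := by
  rw [projL, Matrix.sub_mul, Matrix.one_mul, Matrix.mul_assoc, add_sub_cancel]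

theorem mul_pinv_add_mul_projR (B : Tensor I J) (X : Tensor K I) :
    X * B * B† + X * projR B = X := by
  rw [projR, Matrix.mul_sub, Matrix.mul_one, Matrix.mul_assoc, add_sub_cancel]

/-! ### The equations `A X = E`, `X B = E` and `A X B = E` -/

theorem mul_eq_of_form {A : Tensor I J} {E : Tensor I K} (h : projR A * E = 0) (V : Tensor J K) :
    A * (A† * E + projL A * V) = E := by
  rw [Matrix.mul_add, ← Matrix.mul_assoc, ← Matrix.mul_assoc, mul_projL_self, Matrix.zero_mul,
    add_zero, projR_mul_eq_zero_iff.1 h]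

theorem eq_mul_of_form {B : Tensor I J} {E : Tensor K J} (h : E * projL B = 0) (V : Tensor K I) :
    (E * B† + V * projR B) * B = E := by
  rw [Matrix.add_mul, Matrix.mul_assoc V, projR_mul_self, Matrix.mul_zero, add_zero,
    mul_projL_eq_zero_iff.1 h]

theorem form_of_mul_eq {A : Tensor I J} {X : Tensor J K} {E : Tensor I K} (h : A * X = E) :
    projR A * E = 0 ∧ X = A† * E + projL A * X := by
  subst h
  exact ⟨by rw [← Matrix.mul_assoc, projR_mul_self, Matrix.zero_mul],
    (pinv_mul_add_projL_mul A X).symm⟩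

theorem form_of_eq_mul {B : Tensor I J} {X : Tensor K I} {E : Tensor K J} (h : X * B = E) :
    E * projL B = 0 ∧ X = E * B† + X * projR B := by
  subst h
  exact ⟨by rw [Matrix.mul_assoc, mul_projL_self, Matrix.mul_zero],
    (mul_pinv_add_mul_projR B X).symm⟩

theorem mul_mul_eq_of_form {A : Tensor I J} {B : Tensor K L} {E : Tensor I L}
    (hA : projR A * E = 0) (hB : E * projL B = 0) (U Z : Tensor J K) :
    A * (A† * E * B† + projL A * U + Z * projR B) * B = E := by
  have h1 : A * (projL A * U) = 0 := by rw [← Matrix.mul_assoc, mul_projL_self, Matrix.zero_mul]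
  have h2 : A * (Z * projR B) * B = 0 := by
    simp only [Matrix.mul_assoc, projR_mul_self, Matrix.mul_zero]
  rw [Matrix.mul_add, Matrix.mul_add, h1, add_zero, Matrix.add_mul, h2, add_zero,
    ← Matrix.mul_assoc, ← Matrix.mul_assoc, projR_mul_eq_zero_iff.1 hA,
    mul_projL_eq_zero_iff.1 hB]

theorem form_of_mul_mul_eq {A : Tensor I J} {B : Tensor K L} {X : Tensor J K} {E : Tensor I L}
    (h : A * X * B = E) :
    projR A * E = 0 ∧ E * projL B = 0 ∧
      ∃ U Z : Tensor J K, X = A† * E * B† + projL A * U + Z * projR B := by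
  obtain ⟨h1, h2⟩ := form_of_mul_eq ((Matrix.mul_assoc A X B).symm.trans h)
  obtain ⟨h3, h4⟩ := form_of_eq_mul h
  -- `X` splits as `X * B * B† + X * projR B`, and `X * B` is `A† * E` plus its kernel part `projL A
  -- * (X * B)`.
  refine ⟨h1, h3, X * B * B†, X, ?_⟩
  rw [← Matrix.mul_assoc, ← Matrix.add_mul, ← h2, mul_pinv_add_mul_projR]

/-- The pair of equations `A X = E`, `X B = F`: the general solution is a solution. -/
theorem mul_eq_and_eq_mul_of_form {A : Tensor I J} {B : Tensor K L} {E : Tensor I K}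
    {F : Tensor J L} (hE : projR A * E = 0) (hF : F * projL B = 0) (h : A * F = E * B)
    (U : Tensor J K) :
    A * (A† * E + projL A * F * B† + projL A * U * projR B) = E ∧
      (A† * E + projL A * F * B† + projL A * U * projR B) * B = F := by
  constructor
  · rw [add_assoc, Matrix.mul_assoc, Matrix.mul_assoc, ← Matrix.mul_add, mul_eq_of_form hE]
  · rw [Matrix.add_mul, Matrix.mul_assoc _ _ B, projR_mul_self, Matrix.mul_zero, add_zero,
      Matrix.add_mul, Matrix.mul_assoc _ E, ← h, Matrix.mul_assoc _ F, Matrix.mul_assoc _ _ B,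
      mul_projL_eq_zero_iff.1 hF, pinv_mul_add_projL_mul]

/-- The pair of equations `A X = E`, `X B = F`: solvability conditions and general solution. -/
theorem form_of_mul_eq_and_eq_mul {A : Tensor I J} {B : Tensor K L} {X : Tensor J K}
    {E : Tensor I K} {F : Tensor J L} (hE : A * X = E) (hF : X * B = F) :
    (projR A * E = 0 ∧ F * projL B = 0 ∧ A * F = E * B) ∧
      X = A† * E + projL A * F * B† + projL A * X * projR B := by
  refine ⟨⟨(form_of_mul_eq hE).1, (form_of_eq_mul hF).1, ?_⟩, ?_⟩
  · rw [← hE, ← hF, Matrix.mul_assoc]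
  · rw [add_assoc, Matrix.mul_assoc, Matrix.mul_assoc, ← Matrix.mul_add,
      ← (form_of_eq_mul hF).2, ← (form_of_mul_eq hE).2]

/-! ### The equation `A X B + C Y D = E` -/

section TwoTerm

variable (A : Tensor I J) (B : Tensor K L) (C : Tensor I P) (D : Tensor Q L) (E : Tensor I L)

/-- The solvability conditions of `A X B + C Y D = E`. -/
structure TwoTermConditions : Prop where
  left : projR (projR A * C) * projR A * E = 0
  right : E * projL B * projL (D * projL B) = 0
  mixed : projR A * E * projL D = 0
  mixed' : projR C * E * projL B = 0

variable {A B C D E}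

/-- Elimination of `Y` from the two equations that remain when `X` is eliminated from
`A X B + C Y D = E`. -/
theorem TwoTermConditions.reduce (h : TwoTermConditions A B C D E) :
    (projR A * C)† * E * D† * D = (projR A * C)† * E ∧
    E * projL B - C * ((projR A * C)† * E) * projL B =
      C * projL (projR A * C) * (C† * (E * projL B)) := by
  constructor
  -- This is `mixed` multiplied by `(projR A * C)†`, which absorbs `projR A`.
  · apply mul_projL_eq_zero_iff.1
    rw [← pinv_projR_mul, Matrix.mul_assoc, Matrix.mul_assoc, ← Matrix.mul_assoc _ E, h.mixed,
      Matrix.mul_zero]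
  -- By `mixed'`, `C * C†` fixes `E * projL B`; hence `C† * (E * projL B)` can serve as a particular
  -- value of the unknown multiplied by `C`.
  · have h1 : C * (C† * (E * projL B)) = E * projL B := by
      rw [← Matrix.mul_assoc]
      exact projR_mul_eq_zero_iff.1 (by rw [← Matrix.mul_assoc, h.mixed'])
    have h2 : projR A * (E * projL B) = projR A * C * (C† * (E * projL B)) := by
      rw [Matrix.mul_assoc, h1]
    rw [show projL (projR A * C) = 1 - (projR A * C)† * (projR A * C) from rfl,
      Matrix.mul_sub, Matrix.mul_one, Matrix.sub_mul, h1,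
      Matrix.mul_assoc C, Matrix.mul_assoc C, Matrix.mul_assoc (projR A * C)†,
      Matrix.mul_assoc (projR A * C)†, ← h2, ← Matrix.mul_assoc (projR A * C)† (projR A),
      pinv_projR_mul]

/-- The value of `X` that belongs to the value `Y` of the general solution. -/
theorem TwoTermConditions.particular_eq (h : TwoTermConditions A B C D E)
    {M : Tensor I P} {N : Tensor Q L} {S : Tensor I P} (hM : M = projR A * C) (hS : S = C * projL M)
    (V₁ V₂ V₃ : Tensor P Q) :
    C * (M† * E * D† + S† * S * C† * E * N† + projL M * projL S * V₁
      + projL M * V₂ * projR N + V₃ * projR D) * D =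
    C * M† * E + S * C† * E * N† * D + S * V₂ * projR N * D := by
  -- `S†` absorbs `projL M` on its left, and `C * projL M` is `S`.
  have h1 : C * (S† * S) = S := by
    have : projL M * S† = S† := by rw [hS, projL_mul_pinv_mul_projL]
    rw [← this, ← Matrix.mul_assoc, ← Matrix.mul_assoc, ← hS, Matrix.mul_assoc, mul_pinv_mul]
  have h2 : C * (projL M * (projL S * V₁)) = 0 := by
    rw [← Matrix.mul_assoc, ← Matrix.mul_assoc, ← hS, mul_projL_self, Matrix.zero_mul]
  have h3 : C * (V₃ * projR D) * D = 0 := by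
    simp only [Matrix.mul_assoc, projR_mul_self, Matrix.mul_zero]
  have h4 : M† * E * D† * D = M† * E := by rw [hM]; exact h.reduce.1
  have h5 : C * (S† * S * C† * E * N†) = S * C† * E * N† := by
    simp only [← Matrix.mul_assoc] at h1 ⊢
    rw [h1]
  have h6 : C * (projL M * V₂ * projR N) = S * V₂ * projR N := by
    rw [hS]; simp only [Matrix.mul_assoc]
  rw [Matrix.mul_add, Matrix.add_mul, h3, add_zero, Matrix.mul_add, h6, Matrix.mul_add,
    Matrix.mul_assoc (projL M), h2, add_zero, Matrix.mul_add, h5, Matrix.add_mul, Matrix.add_mul,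
    Matrix.mul_assoc C, h4, ← Matrix.mul_assoc]


/-- Multiplying by `projR A` or by `projL B` removes the `X` term; a second projector then removes
the `Y` term from either side of what is left. The four conditions are the four ways of doing this.
-/
theorem twoTermConditions_of_eq {X : Tensor J K} {Y : Tensor P Q}
    (h : A * X * B + C * Y * D = E) : TwoTermConditions A B C D E := by
  have e1 : projR A * E = projR A * C * (Y * D) := by
    rw [← h, Matrix.mul_add, Matrix.mul_assoc A, ← Matrix.mul_assoc _ A, projR_mul_self,
      Matrix.zero_mul, zero_add]
    simp only [Matrix.mul_assoc]
  have e2 : E * projL B = C * Y * (D * projL B) := by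
    rw [← h, Matrix.add_mul, Matrix.mul_assoc _ B, mul_projL_self, Matrix.mul_zero, zero_add,
      Matrix.mul_assoc]
  constructor
  · rw [Matrix.mul_assoc, e1, ← Matrix.mul_assoc, projR_mul_self, Matrix.zero_mul]
  · rw [e2, Matrix.mul_assoc, mul_projL_self, Matrix.mul_zero]
  · rw [e1, Matrix.mul_assoc, Matrix.mul_assoc Y, mul_projL_self, Matrix.mul_zero, Matrix.mul_zero]
  · rw [Matrix.mul_assoc, e2, Matrix.mul_assoc C, ← Matrix.mul_assoc, projR_mul_self,
      Matrix.zero_mul]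

/-- The equation `A X B + C Y D = E`: the general solution is a solution. -/
theorem TwoTermConditions.eq_of_form (h : TwoTermConditions A B C D E)
    {M : Tensor I P} {N : Tensor Q L} {S : Tensor I P}
    (hM : M = projR A * C) (hN : N = D * projL B) (hS : S = C * projL M)
    {X U Z : Tensor J K} {Y V₁ V₂ V₃ : Tensor P Q}
    (hX : X = A† * E * B† - A† * C * M† * E * B† - A† * S * C† * E * N† * D * B†
      - A† * S * V₂ * projR N * D * B† + projL A * U + Z * projR B)
    (hY : Y = M† * E * D† + S† * S * C† * E * N† + projL M * projL S * V₁
      + projL M * V₂ * projR N + V₃ * projR D) :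
    A * X * B + C * Y * D = E := by
  -- The given `X` is the general solution of `A X B = E - C Y D` for the given `Y`, so it remains
  -- to check the two solvability conditions of this equation, `hA0` and `hB0`.
  have hX' : X = A† * (E - C * Y * D) * B† + projL A * U + Z * projR B := by
    rw [hX, hY, h.particular_eq hM hS]
    simp only [Matrix.mul_sub, Matrix.sub_mul, Matrix.mul_add, Matrix.add_mul, Matrix.mul_assoc]
    abel
  have hT : C * Y * D = C * M† * E + S * C† * E * N† * D + S * V₂ * projR N * D := by
    rw [hY, h.particular_eq hM hS]
  have hPA : M† * projR A = M† := by rw [hM, pinv_projR_mul]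
  have hS0 : projR A * S = 0 := by rw [hS, ← Matrix.mul_assoc, ← hM, mul_projL_self]
  have hPB : E * N† * N = E * projL B := by
    have h1 : projL B * N† = N† := by rw [hN, projL_mul_pinv_mul_projL]
    rw [← h1, ← Matrix.mul_assoc]
    exact mul_projL_eq_zero_iff.1 (by rw [hN]; exact h.right)
  have hA0 : projR A * (E - C * Y * D) = 0 := by
    -- The left side is `M * M†` applied to `projR A * E`, which `left` says is fixed; the other
    -- terms of `C * Y * D` start with `S` and vanish under `projR A`.
    have h1 : projR A * (C * M† * E) = projR A * E := by
      rw [← Matrix.mul_assoc, ← Matrix.mul_assoc, ← hM, ← hPA, ← Matrix.mul_assoc,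
        Matrix.mul_assoc _ _ E]
      exact projR_mul_eq_zero_iff.1 (by rw [hM, ← Matrix.mul_assoc]; exact h.left)
    simp only [hT, Matrix.mul_sub, Matrix.mul_add, h1, Matrix.mul_assoc S]
    simp only [← Matrix.mul_assoc (projR A) S, hS0, Matrix.zero_mul, add_zero, sub_self]
  have hB0 : (E - C * Y * D) * projL B = 0 := by
    have h1 : S * V₂ * projR N * D * projL B = 0 := by
      rw [Matrix.mul_assoc _ D, ← hN, Matrix.mul_assoc, projR_mul_self, Matrix.mul_zero]
    -- `D * projL B` is `N`, and `E * N† * N` equals `E * projL B` by `right`; the second half of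
    -- `reduce` then makes everything cancel.
    have h2 : S * C† * E * N† * D * projL B = S * (C† * (E * projL B)) := by
      rw [Matrix.mul_assoc _ D, ← hN, ← hPB]
      simp only [Matrix.mul_assoc]
    have h3 := h.reduce.2
    rw [← hM, ← hS] at h3
    rw [hT, Matrix.sub_mul, Matrix.add_mul, Matrix.add_mul, h1, add_zero, h2, ← h3,
      ← Matrix.mul_assoc C]
    abel
  have := mul_mul_eq_of_form hA0 hB0 U Z
  rw [← hX'] at this
  rw [this, sub_add_cancel]

/-- The equation `A X B + C Y D = E`: every solution belongs to the general solution. -/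
theorem TwoTermConditions.form_of_eq (h : TwoTermConditions A B C D E)
    {M : Tensor I P} {N : Tensor Q L} {S : Tensor I P}
    (hM : M = projR A * C) (hN : N = D * projL B) (hS : S = C * projL M)
    {X : Tensor J K} {Y : Tensor P Q} (hXY : A * X * B + C * Y * D = E) :
    ∃ (U Z : Tensor J K) (V₁ V₂ V₃ : Tensor P Q),
      X = A† * E * B† - A† * C * M† * E * B† - A† * S * C† * E * N† * D * B†
        - A† * S * V₂ * projR N * D * B† + projL A * U + Z * projR B ∧
      Y = M† * E * D† + S† * S * C† * E * N† + projL M * projL S * V₁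
        + projL M * V₂ * projR N + V₃ * projR D := by
  have hX := eq_sub_of_add_eq hXY
  obtain ⟨-, -, U, Z, hX⟩ := form_of_mul_mul_eq hX
  -- Two equations free of `X`. The first gives `Y` up to `projL M * Y₁` and `V₃ * projR D`;
  -- inserted into the second, it leaves `e3` for `Y₁` alone.
  have e1 : M * Y * D = projR A * E := by
    rw [← hXY, hM, Matrix.mul_add, Matrix.mul_assoc A, ← Matrix.mul_assoc _ A, projR_mul_self,
      Matrix.zero_mul, zero_add]
    simp only [Matrix.mul_assoc]
  have e2 : C * Y * N = E * projL B := by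
    rw [← hXY, hN, Matrix.add_mul, Matrix.mul_assoc _ B, mul_projL_self, Matrix.mul_zero, zero_add,
      ← Matrix.mul_assoc]
  obtain ⟨-, -, Y₁, V₃, hY⟩ := form_of_mul_mul_eq e1
  have hPA : M† * (projR A * E) = M† * E := by rw [hM, ← Matrix.mul_assoc, pinv_projR_mul]
  rw [hPA] at hY
  have e3 : S * Y₁ * N = S * (C† * (E * projL B)) := by
    have h1 := h.reduce
    rw [← hM, ← hS] at h1
    have h2 : C * (V₃ * projR D) * N = 0 := by
      rw [hN]
      simp only [Matrix.mul_assoc]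
      rw [← Matrix.mul_assoc (projR D), projR_mul_self]
      simp only [Matrix.zero_mul, Matrix.mul_zero]
    have h3 : C * (M† * E * D†) * N = C * (M† * E) * projL B := by
      rw [hN, ← Matrix.mul_assoc, Matrix.mul_assoc C, h1.1]
    rw [← h1.2, ← e2, hY, Matrix.mul_add, Matrix.mul_add, Matrix.add_mul, Matrix.add_mul, h2, h3,
      hS, Matrix.mul_assoc C (projL M)]
    abel
  obtain ⟨-, -, V₁, V₂, hY₁⟩ := form_of_mul_mul_eq e3
  have hY' : Y = M† * E * D† + S† * S * C† * E * N† + projL M * projL S * V₁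
      + projL M * V₂ * projR N + V₃ * projR D := by
    -- The particular value of `Y₁` carries `projL M` and `projL B`; they are absorbed by `S†` and
    -- `N†`.
    have h1 : projL M * (S† * (S * (C† * (E * projL B))) * N†) = S† * S * C† * E * N† := by
      have h2 : projL M * S† = S† := by rw [hS, projL_mul_pinv_mul_projL]
      have h3 : projL B * N† = N† := by rw [hN, projL_mul_pinv_mul_projL]
      rw [← Matrix.mul_assoc, ← Matrix.mul_assoc, h2]
      simp only [Matrix.mul_assoc, h3]
    rw [hY, hY₁, Matrix.mul_add, Matrix.mul_add, h1]
    simp only [Matrix.mul_assoc]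
    abel
  refine ⟨U, Z, V₁, V₂, V₃, ?_, hY'⟩
  rw [hX, hY', h.particular_eq hM hS]
  simp only [Matrix.mul_sub, Matrix.sub_mul, Matrix.mul_add, Matrix.add_mul, Matrix.mul_assoc]
  abel

end TwoTerm

end Calculus

/-! ### Block tensors -/

section BlockCalculus

variable {N₀ N M : ℕ} {I : Fin N₀ → ℕ} {J K : Fin N → ℕ}

/-- The embedding of the multi-indices of the first block. -/
def blockInl (j : MultiIndex J) : MultiIndex fun s => J s + K s := fun s => Fin.castAdd (K s) (j s)

/-- The embedding of the multi-indices of the second block. -/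
def blockInr (k : MultiIndex K) : MultiIndex fun s => J s + K s := fun s => Fin.natAdd (J s) (k s)

theorem blockInl_injective : Function.Injective (blockInl (J := J) (K := K)) := fun _ _ h =>
  funext fun s => Fin.castAdd_injective _ _ (congrFun h s)

theorem blockInr_injective : Function.Injective (blockInr (J := J) (K := K)) := fun _ _ h =>
  funext fun s => Fin.natAdd_injective _ _ (congrFun h s)

/-- With no modes there is only the empty multi-index and the two blocks would coincide; one mode
suffices to separate them. -/
theorem blockInl_ne_blockInr (hN : 0 < N) (j : MultiIndex J) (k : MultiIndex K) :
    blockInl j ≠ blockInr k := fun h => by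
  have h1 := congrArg Fin.val (congrFun h ⟨0, hN⟩)
  have h2 := (j ⟨0, hN⟩).isLt
  simp only [blockInl, blockInr, Fin.val_castAdd, Fin.val_natAdd] at h1
  omega

theorem elim_blockInl_blockInr_injective (hN : 0 < N) :
    Function.Injective (Sum.elim (blockInl (J := J) (K := K)) blockInr) :=
  blockInl_injective.sumElim blockInr_injective (blockInl_ne_blockInr hN)

theorem rowBlock_blockInl (A : Tensor I J) (B : Tensor I K) (i : MultiIndex I)
    (j : MultiIndex J) : rowBlock A B i (blockInl j) = A i j :=
  dif_pos fun s => (j s).isLt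

theorem rowBlock_blockInr (hN : 0 < N) (A : Tensor I J) (B : Tensor I K) (i : MultiIndex I)
    (k : MultiIndex K) : rowBlock A B i (blockInr k) = B i k := by
  have h1 : ¬ ∀ s, (blockInr (J := J) k s : ℕ) < J s := fun h => by
    have h2 := h ⟨0, hN⟩
    simp only [blockInr, Fin.val_natAdd] at h2
    omega
  have h2 : ∀ s, J s ≤ (blockInr (J := J) k s : ℕ) := fun s => by
    simp only [blockInr, Fin.val_natAdd]
    omega
  rw [rowBlock, dif_neg h1, dif_pos h2]
  congr 1
  funext s
  ext
  simp only [blockInr, Fin.val_natAdd]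
  omega

theorem rowBlock_of_notMem_range (A : Tensor I J) (B : Tensor I K) (i : MultiIndex I)
    {l : MultiIndex fun s => J s + K s} (hl : l ∉ Set.range (Sum.elim blockInl blockInr)) :
    rowBlock A B i l = 0 := by
  rw [rowBlock, dif_neg, dif_neg]
  · intro h
    refine hl ⟨Sum.inr fun s => ⟨l s - J s, ?_⟩, funext fun s => Fin.ext ?_⟩
    · have h1 := h s
      have h2 : (l s : ℕ) < J s + K s := (l s).isLt
      omega
    · have h1 := h s
      simp only [Sum.elim_inr, blockInr, Fin.val_natAdd]
      omega
  · exact fun h => hl ⟨Sum.inl fun s => ⟨l s, h s⟩, rfl⟩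

/-- Column blocks are reduced to row blocks by the conjugate transpose, which reverses products over
the noncommutative quaternions, as the plain transpose does not. -/
theorem conjTranspose_colBlock (C : Tensor J I) (D : Tensor K I) :
    (colBlock C D)ᴴ = rowBlock Cᴴ Dᴴ := by
  ext1 i l
  rw [Matrix.conjTranspose_apply, colBlock, rowBlock]
  split_ifs
  · rfl
  · rfl
  · exact star_zero _

/-- The product of a row block tensor with an arbitrary tensor. -/
theorem rowBlock_mul (hN : 0 < N) {P : Fin M → ℕ} (A : Tensor I J) (B : Tensor I K)
    (X : Tensor (fun s => J s + K s) P) :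
    rowBlock A B * X = A * X.submatrix blockInl id + B * X.submatrix blockInr id := by
  ext1 i p
  -- With several modes the two blocks do not exhaust the multi-indices; at the mixed ones the row
  -- block vanishes, so the sum runs over the two images only.
  rw [Matrix.add_apply, Matrix.mul_apply, Matrix.mul_apply, Matrix.mul_apply,
    ← Fintype.sum_of_injective _ (elim_blockInl_blockInr_injective hN)
      (fun l => rowBlock A B i (Sum.elim blockInl blockInr l) *
        X (Sum.elim blockInl blockInr l) p) _
      (fun l hl => by rw [rowBlock_of_notMem_range A B i hl, zero_mul]) (fun _ => rfl),
    Fintype.sum_sum_type]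
  simp only [Sum.elim_inl, Sum.elim_inr, rowBlock_blockInl, rowBlock_blockInr hN,
    Matrix.submatrix_apply, id]

/-- The product of an arbitrary tensor with a column block tensor. -/
theorem mul_colBlock (hN : 0 < N) {P : Fin M → ℕ} (C : Tensor J I) (D : Tensor K I)
    (Y : Tensor P (fun s => J s + K s)) :
    Y * colBlock C D = Y.submatrix id blockInl * C + Y.submatrix id blockInr * D := by
  apply Matrix.conjTranspose_injective
  rw [Matrix.conjTranspose_mul, conjTranspose_colBlock, rowBlock_mul hN,
    Matrix.conjTranspose_add, Matrix.conjTranspose_mul, Matrix.conjTranspose_mul]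
  rfl

theorem colBlock_submatrix_inl (C : Tensor J I) (D : Tensor K I) :
    (colBlock C D).submatrix blockInl id = C := by
  ext1 j i
  exact dif_pos fun s => (j s).isLt

theorem colBlock_submatrix_inr (hN : 0 < N) (C : Tensor J I) (D : Tensor K I) :
    (colBlock C D).submatrix blockInr id = D := by
  apply Matrix.conjTranspose_injective
  ext1 i k
  have h := congrFun (congrFun (conjTranspose_colBlock C D) i) (blockInr k)
  rw [rowBlock_blockInr hN] at h
  exact h

theorem rowBlock_submatrix_inl (A : Tensor I J) (B : Tensor I K) :
    (rowBlock A B).submatrix id blockInl = A := by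
  ext1 i j
  exact rowBlock_blockInl A B i j

theorem rowBlock_submatrix_inr (hN : 0 < N) (A : Tensor I J) (B : Tensor I K) :
    (rowBlock A B).submatrix id blockInr = B := by
  ext1 i k
  exact rowBlock_blockInr hN A B i k

theorem selRow_mul (hN : 0 < N) {P : Fin M → ℕ} (X : Tensor (dbl J) P) :
    selRow J * X = X.submatrix blockInl id := by
  rw [selRow, rowBlock_mul hN, Matrix.one_mul, Matrix.zero_mul, add_zero]

theorem mul_selCol (hN : 0 < N) {P : Fin M → ℕ} (Y : Tensor P (dbl J)) :
    Y * selCol J = Y.submatrix id blockInl := by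
  rw [selCol, mul_colBlock hN, Matrix.mul_one, Matrix.mul_zero, add_zero]

end BlockCalculus

/-! ### The equation `A X + Y B = E` -/

section Sylvester

variable {N₁ N₂ N₃ N₄ : ℕ} {I : Fin N₁ → ℕ} {J : Fin N₂ → ℕ} {K : Fin N₃ → ℕ} {L : Fin N₄ → ℕ}
  {A : Tensor I J} {B : Tensor K L} {E : Tensor I L}

/-- The `H₂` terms cancel, the `H₁` and `H₃` terms are annihilated, and `h` makes `B† * B` fix
`projR A * E`; what remains is `A * A† * E + projR A * E`. -/
theorem mul_add_mul_eq_of_form (h : projR A * E * projL B = 0) (H₁ : Tensor J L)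
    (H₂ H₃ : Tensor I K) :
    A * (A† * E - A† * H₂ * B + projL A * H₁)
      + (projR A * E * B† + A * A† * H₂ + H₃ * projR B) * B = E := by
  have h1 : A * (projL A * H₁) = 0 := by rw [← Matrix.mul_assoc, mul_projL_self, Matrix.zero_mul]
  have h2 : H₃ * projR B * B = 0 := by rw [Matrix.mul_assoc, projR_mul_self, Matrix.mul_zero]
  have h3 : projR A * E = E - A * (A† * E) := by
    rw [projR, Matrix.sub_mul, Matrix.one_mul, Matrix.mul_assoc]
  rw [Matrix.mul_add, h1, Matrix.add_mul, h2, Matrix.add_mul, mul_projL_eq_zero_iff.1 h, h3,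
    Matrix.mul_sub]
  simp only [Matrix.mul_assoc]
  abel

/-- A solution is its own parameter: `X`, `Y` and `projR A * Y` play the roles of `H₁`, `H₂` and
`H₃`. -/
theorem form_of_mul_add_mul_eq {X : Tensor J L} {Y : Tensor I K} (h : A * X + Y * B = E) :
    projR A * E * projL B = 0 ∧
      X = A† * E - A† * Y * B + projL A * X ∧
      Y = projR A * E * B† + A * A† * Y + projR A * Y * projR B := by
  have h1 : projR A * E = projR A * Y * B := by
    rw [← h, Matrix.mul_add, ← Matrix.mul_assoc, projR_mul_self, Matrix.zero_mul, zero_add,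
      Matrix.mul_assoc]
  refine ⟨?_, ?_, ?_⟩
  · rw [h1, Matrix.mul_assoc, mul_projL_self, Matrix.mul_zero]
  · rw [Matrix.mul_assoc, ← Matrix.mul_sub, ← h, add_sub_cancel_right, pinv_mul_add_projL_mul]
  · rw [h1, add_right_comm, mul_pinv_add_mul_projR, projR, Matrix.sub_mul, Matrix.one_mul,
      sub_add_cancel]

end Sylvester

/-! ### Block equations, for matching two general forms -/

section BlockSylvester

variable {N₀ N M N₄ : ℕ} {I : Fin N₀ → ℕ} {J : Fin N → ℕ} {K : Fin M → ℕ} {L : Fin N₄ → ℕ}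
  {A A' : Tensor I J} {B B' : Tensor K L} {E : Tensor I L}
  {a : Tensor I (dbl J)} {b : Tensor (dbl K) L}

/-- The equation `A X + A' X' + Y B + Y' B' = E`: the general form of `(X, Y)` extends to a
solution. -/
theorem exists_block_eq_of_form (hN : 0 < N) (hM : 0 < M) (ha : a = rowBlock A A')
    (hb : b = colBlock B B') (h : projR a * E * projL b = 0)
    {X : Tensor J L} {Y : Tensor I K} {H₁ : Tensor (dbl J) L} {H₂ H₃ : Tensor I (dbl K)}
    (hX : X = selRow J * (a† * E - a† * H₂ * b + projL a * H₁))
    (hY : Y = (projR a * E * b† + a * a† * H₂ + H₃ * projR b) * selCol K) :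
    ∃ (X' : Tensor J L) (Y' : Tensor I K), A * X + A' * X' + Y * B + Y' * B' = E := by
  have h1 := mul_add_mul_eq_of_form h H₁ H₂ H₃
  rw [selRow_mul hN] at hX
  rw [mul_selCol hM] at hY
  generalize a† * E - a† * H₂ * b + projL a * H₁ = x at h1 hX
  generalize projR a * E * b† + a * a† * H₂ + H₃ * projR b = y at h1 hY
  -- The selectors keep the first blocks of a solution of the block equation; its second blocks are
  -- the missing unknowns.
  refine ⟨x.submatrix blockInr id, y.submatrix id blockInr, ?_⟩
  rw [hX, hY, ← h1, ha, hb, rowBlock_mul hN, mul_colBlock hM, add_assoc (_ + _)]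

/-- The equation `A X + A' X' + Y B + Y' B' = E`: solvability condition and general form of
`(X, Y)`. -/
theorem form_of_block_eq (hN : 0 < N) (hM : 0 < M) (ha : a = rowBlock A A')
    (hb : b = colBlock B B') {X X' : Tensor J L} {Y Y' : Tensor I K}
    (h : A * X + A' * X' + Y * B + Y' * B' = E) :
    projR a * E * projL b = 0 ∧ ∃ (H₁ : Tensor (dbl J) L) (H₂ H₃ : Tensor I (dbl K)),
      X = selRow J * (a† * E - a† * H₂ * b + projL a * H₁) ∧
      Y = (projR a * E * b† + a * a† * H₂ + H₃ * projR b) * selCol K := by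
  have h1 : a * colBlock X X' + rowBlock Y Y' * b = E := by
    rw [ha, hb, rowBlock_mul hN, mul_colBlock hM, colBlock_submatrix_inl,
      colBlock_submatrix_inr hN, rowBlock_submatrix_inl, rowBlock_submatrix_inr hM, ← h,
      add_assoc (_ + _)]
  obtain ⟨h2, h3, h4⟩ := form_of_mul_add_mul_eq h1
  refine ⟨h2, colBlock X X', rowBlock Y Y', projR a * rowBlock Y Y', ?_, ?_⟩
  · rw [← h3, selRow_mul hN, colBlock_submatrix_inl]
  · rw [← h4, mul_selCol hM, rowBlock_submatrix_inl]

/-- A variant of `exists_block_eq_of_form` with another parametrization. -/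
theorem exists_block_eq_of_form' (hN : 0 < N) (hM : 0 < M) (ha : a = rowBlock A A')
    (hb : b = colBlock B B') (h : projR a * E * projL b = 0)
    {X : Tensor J L} {Y : Tensor I K} {W₁ : Tensor (dbl J) (dbl K)} {W₂ : Tensor (dbl J) L}
    {W₃ : Tensor I (dbl K)}
    (hX : X = selRow J * (a† * E + W₁ * b + projL a * W₂))
    (hY : Y = (projR a * E * b† - a * W₁ - W₃ * projR b) * selCol K) :
    ∃ (X' : Tensor J L) (Y' : Tensor I K), A * X + A' * X' + Y * B + Y' * B' = E := by
  -- The witnesses come from splitting `W₁ * b` into `a† * a * W₁ * b`, which is the `H₂` term, and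
  -- a kernel part, which joins `W₂`.
  refine exists_block_eq_of_form hN hM ha hb h (H₁ := W₂ + W₁ * b) (H₂ := -(a * W₁)) (H₃ := -W₃)
    ?_ ?_
  · have h1 : a† * E + W₁ * b + projL a * W₂ =
        a† * E - a† * -(a * W₁) * b + projL a * (W₂ + W₁ * b) := by
      conv_lhs => rw [← pinv_mul_add_projL_mul a (W₁ * b)]
      simp only [Matrix.mul_add, Matrix.mul_neg, Matrix.neg_mul, Matrix.mul_assoc]
      abel
    rw [hX, h1]
  · rw [hY, Matrix.mul_neg, Matrix.mul_assoc a a†, ← Matrix.mul_assoc a† a, ← Matrix.mul_assoc a,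
      mul_pinv_mul, Matrix.neg_mul, sub_eq_add_neg, sub_eq_add_neg]

/-- A variant of `form_of_block_eq` with another parametrization. -/
theorem form_of_block_eq' (hN : 0 < N) (hM : 0 < M) (ha : a = rowBlock A A')
    (hb : b = colBlock B B') {X X' : Tensor J L} {Y Y' : Tensor I K}
    (h : A * X + A' * X' + Y * B + Y' * B' = E) :
    projR a * E * projL b = 0 ∧ ∃ (W₁ : Tensor (dbl J) (dbl K)) (W₂ : Tensor (dbl J) L)
      (W₃ : Tensor I (dbl K)),
      X = selRow J * (a† * E + W₁ * b + projL a * W₂) ∧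
      Y = (projR a * E * b† - a * W₁ - W₃ * projR b) * selCol K := by
  obtain ⟨h1, H₁, H₂, H₃, h2, h3⟩ := form_of_block_eq hN hM ha hb h
  refine ⟨h1, -(a† * H₂), H₁, -H₃, ?_, ?_⟩
  · rw [h2, Matrix.neg_mul, sub_eq_add_neg]
  · rw [h3, Matrix.mul_neg, Matrix.neg_mul, sub_neg_eq_add, sub_neg_eq_add, Matrix.mul_assoc a]

end BlockSylvester

/-- This is the descent step: the solvability condition of a block equation, read as an equation for
the parameter `V` left in its right-hand side. -/
theorem projR_mul_sub_mul_projL_eq_zero_iff {N₁ N₂ N₃ N₄ N₅ N₆ : ℕ} {I : Fin N₁ → ℕ}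
    {J : Fin N₂ → ℕ} {K : Fin N₃ → ℕ} {L : Fin N₄ → ℕ} {P : Fin N₅ → ℕ} {Q : Fin N₆ → ℕ}
    {A : Tensor I J} {B : Tensor K L} {C : Tensor I P} {V : Tensor P Q} {D : Tensor Q L}
    {E : Tensor I L} :
    projR A * (E - C * V * D) * projL B = 0 ↔
      projR A * C * V * (D * projL B) = projR A * E * projL B := by
  rw [Matrix.mul_sub, Matrix.sub_mul, sub_eq_zero, eq_comm]
  simp only [Matrix.mul_assoc]

/-! ### Elimination of `X` and `Y` from `A X = E`, `Y B = E'`, `C X D + F Y H + F Θ D = K` -/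

section Outer

variable {N₁ N₂ N₃ N₄ N₅ N₆ : ℕ} {I : Fin N₁ → ℕ} {J : Fin N₂ → ℕ} {K : Fin N₃ → ℕ}
  {L : Fin N₄ → ℕ} {P : Fin N₅ → ℕ} {Q : Fin N₆ → ℕ}

/-- The term `C * Θ * B` is annihilated in three of the conditions, by `projR (projR A * C)`, `projL
B` and `projR C`. Only the `mixed` one sees `Θ`, and becomes the equation that carries the
elimination on to `X3`, `Y3` and `W`. -/
theorem twoTermConditions_sub_iff {A : Tensor I J} {B : Tensor K L} {C : Tensor I P}
    {D : Tensor Q L} {E : Tensor I L} {Θ : Tensor P K} :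
    TwoTermConditions A B C D (E - C * Θ * B) ↔
      projR (projR A * C) * projR A * E = 0 ∧ E * projL B * projL (D * projL B) = 0 ∧
      projR C * E * projL B = 0 ∧
      projR A * C * Θ * (B * projL D) = projR A * E * projL D := by
  have h1 : projR (projR A * C) * projR A * (C * Θ * B) = 0 := by
    rw [Matrix.mul_assoc C, ← Matrix.mul_assoc, Matrix.mul_assoc _ _ C, projR_mul_self,
      Matrix.zero_mul]
  have h2 : C * Θ * B * projL B = 0 := by
    rw [Matrix.mul_assoc, mul_projL_self, Matrix.mul_zero]
  have h3 : projR C * (C * Θ * B) = 0 := by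
    rw [Matrix.mul_assoc C, ← Matrix.mul_assoc, projR_mul_self, Matrix.zero_mul]
  constructor
  · rintro ⟨a, b, c, e⟩
    rw [Matrix.mul_sub, h1, sub_zero] at a
    rw [Matrix.sub_mul E, h2, sub_zero] at b
    rw [Matrix.mul_sub, h3, sub_zero] at e
    exact ⟨a, b, e, projR_mul_sub_mul_projL_eq_zero_iff.1 c⟩
  · rintro ⟨a, b, e, c⟩
    refine ⟨?_, ?_, projR_mul_sub_mul_projL_eq_zero_iff.2 c, ?_⟩
    · rw [Matrix.mul_sub, h1, sub_zero, a]
    · rw [Matrix.sub_mul E, h2, sub_zero, b]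
    · rw [Matrix.mul_sub, h3, sub_zero, e]

end Outer

/-! ### The eliminations in the given system, inwards and outwards -/

namespace SystemData

variable {N M : ℕ} {δ : Dims N M} {d : SystemData δ} {u : Unknowns δ}

/-- The ninth equation after the substitution of the general forms of `X1` and `X2`. -/
theorem eq9_iff {V : Tensor δ.E δ.F} {Z : Tensor δ.G δ.H}
    (hX1 : u.X1 = d.A4† * d.E5 + projL d.A4 * V)
    (hX2 : u.X2 = d.E6 * d.B4† + Z * projR d.B4) :
    d.A6 * u.X1 * d.B6 + d.A7 * u.X2 * d.B7
      + d.A7 * (d.C3 * u.X3 * d.D3 + d.C4 * u.W * d.D4) * d.B6 = d.E9 ↔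
    d.Ah6 * V * d.B6 + d.A7 * Z * d.Bh7 =
      d.Eh9 - d.A7 * (d.C3 * u.X3 * d.D3 + d.C4 * u.W * d.D4) * d.B6 := by
  rw [hX1, hX2, Ah6, Bh7, Eh9]
  constructor <;> intro h
  all_goals
    -- Both equations have the same difference of sides up to distributing products; as these do not
    -- commute, additive normalization finishes.
    linear_combination (norm := skip) h
    simp only [Matrix.mul_add, Matrix.add_mul, Matrix.mul_assoc]
    abel

/-- The tenth equation after the substitution of the general forms of `Y1` and `Y2`. -/
theorem eq10_iff {V : Tensor δ.V δ.D} {Z : Tensor δ.G δ.U}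
    (hY1 : u.Y1 = d.A5† * d.E7 + projL d.A5 * V)
    (hY2 : u.Y2 = d.E8 * d.B5† + Z * projR d.B5) :
    d.A8 * u.Y1 * d.B8 + d.A9 * u.Y2 * d.B9
      + d.A9 * (d.H3 * u.Y3 * d.J3 + d.H4 * u.W * d.J4) * d.B8 = d.E10 ↔
    d.Ah8 * V * d.B8 + d.A9 * Z * d.Bh9 =
      d.Eh10 - d.A9 * (d.H3 * u.Y3 * d.J3 + d.H4 * u.W * d.J4) * d.B8 := by
  rw [hY1, hY2, Ah8, Bh9, Eh10]
  constructor <;> intro h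
  all_goals
    linear_combination (norm := skip) h
    simp only [Matrix.mul_add, Matrix.add_mul, Matrix.mul_assoc]
    abel

/-- The equation for `X3` and `W` after the substitution of the general form of `W`. -/
theorem eqG_iff {X : Tensor δ.J δ.L} {W U : Tensor δ.P δ.T}
    (hW : W = d.A3† * d.E3 + projL d.A3 * d.E4 * d.B3† + projL d.A3 * U * projR d.B3) :
    projR d.Ah6 * d.A7 * (d.C3 * X * d.D3 + d.C4 * W * d.D4) * (d.B6 * projL d.Bh7) =
      projR d.Ah6 * d.Eh9 * projL d.Bh7 ↔
    d.Ah4 * X * d.Bh4 + d.C6 * U * d.D6 = d.G := by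
  rw [hW, Ah4, Bh4, C6, D6, G, Ph, Ch4, Dh4, M11]
  constructor <;> intro h
  all_goals
    linear_combination (norm := skip) h
    simp only [Matrix.mul_add, Matrix.add_mul, Matrix.mul_assoc]
    abel

/-- The equation for `Y3` and `W` after the substitution of the general form of `W`. -/
theorem eqF_iff {Y : Tensor δ.Q δ.S} {W U : Tensor δ.P δ.T}
    (hW : W = d.A3† * d.E3 + projL d.A3 * d.E4 * d.B3† + projL d.A3 * U * projR d.B3) :
    projR d.Ah8 * d.A9 * (d.H3 * Y * d.J3 + d.H4 * W * d.J4) * (d.B8 * projL d.Bh9) =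
      projR d.Ah8 * d.Eh10 * projL d.Bh9 ↔
    d.Ah5 * Y * d.Bh5 + d.C7 * U * d.D7 = d.F := by
  rw [hW, Ah5, Bh5, C7, D7, F, Qh, Ch5, Dh5, M22]
  constructor <;> intro h
  all_goals
    linear_combination (norm := skip) h
    simp only [Matrix.mul_add, Matrix.add_mul, Matrix.mul_assoc]
    abel

/-- The equation for `V2` and `T2`. -/
theorem eqE0_iff {V T : Tensor δ.P δ.T} :
    projR d.A11 * (d.E11 - projL d.M1 * V * projR d.N1 - projL d.M2 * T * projR d.N2)
      * projL d.B11 = 0 ↔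
    d.A0 * V * d.B0 + d.C0 * T * d.D0 = d.E0 := by
  rw [A0, B0, C0, D0, E0]
  constructor <;> intro h
  all_goals
    linear_combination (norm := skip) -h
    simp only [Matrix.mul_sub, Matrix.sub_mul, Matrix.mul_assoc]
    abel

/-- The two general forms of `U5` agree if and only if a block equation holds. -/
theorem eqE11_iff {U V₁ V₂ V₃ T₁ T₂ T₃ : Tensor δ.P δ.T}
    (hU : U = d.M1† * d.G * d.D6† + d.S1† * d.S1 * d.C6† * d.G * d.N1†
      + projL d.M1 * projL d.S1 * V₁ + projL d.M1 * V₂ * projR d.N1 + V₃ * projR d.D6) :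
    projL d.M1 * projL d.S1 * V₁ + projL d.M2 * projL d.S2 * T₁ + V₃ * projR d.D6
      + T₃ * projR d.D7 =
      d.E11 - projL d.M1 * V₂ * projR d.N1 - projL d.M2 * T₂ * projR d.N2 ↔
    U = d.M2† * d.F * d.D7† + d.S2† * d.S2 * d.C7† * d.F * d.N2†
      + projL d.M2 * projL d.S2 * (-T₁) + projL d.M2 * (-T₂) * projR d.N2
      + (-T₃) * projR d.D7 := by
  rw [E11]
  constructor <;> intro h
  · linear_combination (norm := skip) h + hU
    simp only [Matrix.mul_neg, Matrix.neg_mul, Matrix.mul_assoc]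
    abel
  · linear_combination (norm := skip) h - hU
    simp only [Matrix.mul_neg, Matrix.neg_mul, Matrix.mul_assoc]
    abel

/-- The two general forms of `X3` agree if and only if a block equation holds. -/
theorem eqE22_iff {X U Z U' Z' : Tensor δ.J δ.L} {V : Tensor δ.P δ.T}
    (hX : X = d.A1† * d.E1 * d.B1† + projL d.A1 * U + Z * projR d.B1) :
    projL d.A1 * U + projL d.Ah4 * U' + Z * projR d.B1 + Z' * projR d.Bh4 =
      d.E22 - d.C22 * V * d.D22 ↔
    X = d.Ah4† * d.G * d.Bh4† - d.Ah4† * d.C6 * d.M1† * d.G * d.Bh4†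
      - d.Ah4† * d.S1 * d.C6† * d.G * d.N1† * d.D6 * d.Bh4†
      - d.Ah4† * d.S1 * V * projR d.N1 * d.D6 * d.Bh4†
      + projL d.Ah4 * (-U') + (-Z') * projR d.Bh4 := by
  rw [E22, C22, D22]
  constructor <;> intro h
  · linear_combination (norm := skip) h + hX
    simp only [Matrix.mul_neg, Matrix.neg_mul, Matrix.mul_assoc]
    abel
  · linear_combination (norm := skip) h - hX
    simp only [Matrix.mul_neg, Matrix.neg_mul, Matrix.mul_assoc]
    abel

/-- The two general forms of `Y3` agree if and only if a block equation holds. -/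
theorem eqE44_iff {Y U Z U' Z' : Tensor δ.Q δ.S} {V : Tensor δ.P δ.T}
    (hY : Y = d.A2† * d.E2 * d.B2† + projL d.A2 * U + Z * projR d.B2) :
    projL d.A2 * U + projL d.Ah5 * U' + Z * projR d.B2 + Z' * projR d.Bh5 =
      d.E44 - d.C44 * V * d.D44 ↔
    Y = d.Ah5† * d.F * d.Bh5† - d.Ah5† * d.C7 * d.M2† * d.F * d.Bh5†
      - d.Ah5† * d.S2 * d.C7† * d.F * d.N2† * d.D7 * d.Bh5†
      - d.Ah5† * d.S2 * (-V) * projR d.N2 * d.D7 * d.Bh5†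
      + projL d.Ah5 * (-U') + (-Z') * projR d.Bh5 := by
  rw [E44, C44, D44]
  constructor <;> intro h
  · linear_combination (norm := skip) h + hY
    simp only [Matrix.mul_neg, Matrix.neg_mul, Matrix.mul_assoc]
    abel
  · linear_combination (norm := skip) h - hY
    simp only [Matrix.mul_neg, Matrix.neg_mul, Matrix.mul_assoc]
    abel

/-- The two general forms of `V2` agree if and only if a block equation holds. -/
theorem eqE66_iff {V U Z U' Z' W : Tensor δ.P δ.T}
    (hV : V = d.A0† * d.E0 * d.B0† - d.A0† * d.C0 * d.M0† * d.E0 * d.B0†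
      - d.A0† * d.S0 * d.C0† * d.E0 * d.N0† * d.D0 * d.B0†
      - d.A0† * d.S0 * W * projR d.N0 * d.D0 * d.B0† + projL d.A0 * U + Z * projR d.B0) :
    projL d.A0 * U + projL d.A33 * U' + Z * projR d.B0 + Z' * projR d.B33 =
      d.E66 - d.C66 * W * d.D66 ↔
    V = d.A33† * d.E33 * d.B33† + projL d.A33 * (-U') + (-Z') * projR d.B33 := by
  rw [E66, C66, D66]
  constructor <;> intro h
  · linear_combination (norm := skip) h + hV
    simp only [Matrix.mul_neg, Matrix.neg_mul, Matrix.mul_assoc]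
    abel
  · linear_combination (norm := skip) h - hV
    simp only [Matrix.mul_neg, Matrix.neg_mul, Matrix.mul_assoc]
    abel

/-- The two general forms of `T2` agree if and only if a block equation holds. -/
theorem eqE88_iff {T U Z U' Z' W : Tensor δ.P δ.T}
    (hT : T = d.M0† * d.E0 * d.D0† + d.S0† * d.S0 * d.C0† * d.E0 * d.N0†
      + projL d.M0 * projL d.S0 * U + projL d.M0 * W * projR d.N0 + Z * projR d.D0) :
    projL d.M0 * projL d.S0 * U + projL d.A55 * U' + Z * projR d.D0 + Z' * projR d.B55 =
      d.E88 - d.C88 * W * d.D88 ↔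
    T = d.A55† * d.E55 * d.B55† + projL d.A55 * (-U') + (-Z') * projR d.B55 := by
  rw [E88, C88, D88]
  constructor <;> intro h
  · linear_combination (norm := skip) h + hT
    simp only [Matrix.mul_neg, Matrix.neg_mul, Matrix.mul_assoc]
    abel
  · linear_combination (norm := skip) h - hT
    simp only [Matrix.mul_neg, Matrix.neg_mul, Matrix.mul_assoc]
    abel

/-- The two general forms of `W4` agree if and only if a block equation holds. -/
theorem eqEt_iff {W U Z U' Z' : Tensor δ.P δ.T}
    (hW : W = d.A77† * d.E77 * d.B77† - projL d.A77 * U - Z * projR d.B77) :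
    projL d.A77 * U + (-projL d.A99) * U' + Z * projR d.B77 + Z' * (-projR d.B99) = d.Et ↔
    W = d.A99† * d.E99 * d.B99† + projL d.A99 * (-U') + (-Z') * projR d.B99 := by
  rw [Et]
  constructor <;> intro h
  · linear_combination (norm := skip) hW - h
    simp only [Matrix.mul_neg, Matrix.neg_mul, Matrix.mul_assoc]
    abel
  · linear_combination (norm := skip) hW - h
    simp only [Matrix.mul_neg, Matrix.neg_mul, Matrix.mul_assoc]
    abel

/-- Every solution of the system satisfies the solvability conditions and belongs to the general
solution. -/
theorem IsSolution.conditions_and_form (hN : 0 < N) (hM : 0 < M) (h : d.IsSolution u) :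
    d.SolvabilityConditions ∧ ∃ p : Params δ, u = d.generalSolution p := by
  -- In the forms obtained from the one-sided equations the free parameter is the unknown itself; so
  -- `X1` and `X2` stand for `V11` and `V22` below, and `W` stands for `U5`.
  obtain ⟨c1, hX1⟩ := form_of_mul_eq h.eq3
  obtain ⟨c2, hX2⟩ := form_of_eq_mul h.eq4
  obtain ⟨c3, hY1⟩ := form_of_mul_eq h.eq5
  obtain ⟨c4, hY2⟩ := form_of_eq_mul h.eq6
  obtain ⟨⟨c11, c12, c13⟩, hW⟩ := form_of_mul_eq_and_eq_mul h.eq7 h.eq8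
  have e9 := (eq9_iff hX1 hX2).1 h.eq9
  have e10 := (eq10_iff hY1 hY2).1 h.eq10
  have t9 := twoTermConditions_of_eq e9
  have t10 := twoTermConditions_of_eq e10
  obtain ⟨T41, T51, T11, T21, T31, hV11, hV22⟩ := t9.form_of_eq (M := d.M11) (N := d.N11)
    (S := d.S11) rfl rfl rfl e9
  obtain ⟨J41, J51, J11, J21, J31, hV33, hV44⟩ := t10.form_of_eq (M := d.M22) (N := d.N22)
    (S := d.S22) rfl rfl rfl e10
  obtain ⟨c5, c6, c7, hP⟩ := twoTermConditions_sub_iff.1 t9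
  obtain ⟨c8, c9, c10, hQ⟩ := twoTermConditions_sub_iff.1 t10
  have eG := (eqG_iff hW).1 hP
  have eF := (eqF_iff hW).1 hQ
  have tG := twoTermConditions_of_eq eG
  have tF := twoTermConditions_of_eq eF
  obtain ⟨Z₁, Z₂, V₁, V₂, V₃, hX3', hU⟩ := tG.form_of_eq (M := d.M1) (N := d.N1) (S := d.S1)
    rfl rfl rfl eG
  obtain ⟨Z₃, Z₄, T₁, T₂, T₃, hY3', hU'⟩ := tF.form_of_eq (M := d.M2) (N := d.N2) (S := d.S2)
    rfl rfl rfl eF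
  -- The terms in `V2` and `T2` enter the block equation with equal signs, so the form of `U5`
  -- coming from `F` must carry `-T₂`.
  obtain ⟨T₂, rfl⟩ := neg_surjective T₂
  have e11 := (eqE11_iff (T₁ := -T₁) (T₂ := T₂) (T₃ := -T₃) hU).2 (by
    rw [neg_neg, neg_neg]; exact hU')
  obtain ⟨c11', W₁, W₂, W₃, hV₁, hV₃⟩ := form_of_block_eq' (a := d.A11) (b := d.B11) hN hM rfl rfl
    e11
  have e0 := eqE0_iff.1 c11'
  have t0 := twoTermConditions_of_eq e0
  obtain ⟨W₅, W₆, W₇, W₄, W₈, hV₂, hT₂⟩ := t0.form_of_eq (M := d.M0) (N := d.N0) (S := d.S0)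
    rfl rfl rfl e0
  obtain ⟨c26, c27, U₁, U₂, hX3⟩ := form_of_mul_mul_eq h.eq1
  obtain ⟨c28, c29, U₃, U₄, hY3⟩ := form_of_mul_mul_eq h.eq2
  have e22 := (eqE22_iff (U' := -Z₁) (Z' := -Z₂) (V := V₂) hX3).2 (by
    rw [neg_neg, neg_neg]; exact hX3')
  have e44 := (eqE44_iff (U' := -Z₃) (Z' := -Z₄) (V := T₂) hY3).2 (by
    rw [neg_neg, neg_neg]; exact hY3')
  obtain ⟨c22', H11, H12, H13, hU₁, hU₂⟩ := form_of_block_eq (a := d.A22) (b := d.B22) hN hM rfl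
    rfl e22
  obtain ⟨c44', H21, H22, H23, hU₃, hU₄⟩ := form_of_block_eq (a := d.A44) (b := d.B44) hN hM rfl
    rfl e44
  -- The two forms of `X3` can agree only if `V₂` satisfies this second equation, besides `e0`; the
  -- same holds for `T₂` in `e55`.
  have e33 : d.A33 * V₂ * d.B33 = d.E33 := projR_mul_sub_mul_projL_eq_zero_iff.1 c22'
  obtain ⟨c30, c31, Z₅, Z₆, hV₂'⟩ := form_of_mul_mul_eq e33
  have e55 : d.A55 * T₂ * d.B55 = d.E55 := projR_mul_sub_mul_projL_eq_zero_iff.1 c44'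
  obtain ⟨c32, c33, Z₇, Z₈, hT₂'⟩ := form_of_mul_mul_eq e55
  have e66 := (eqE66_iff (U' := -Z₅) (Z' := -Z₆) hV₂).2 (by
    rw [neg_neg, neg_neg]; exact hV₂')
  have e88 := (eqE88_iff (U' := -Z₇) (Z' := -Z₈) hT₂).2 (by
    rw [neg_neg, neg_neg]; exact hT₂')
  obtain ⟨c66', H31, H32, H33, hW₅, hW₆⟩ := form_of_block_eq (a := d.A66) (b := d.B66) hN hM rfl
    rfl e66
  obtain ⟨c88', H41, H42, H43, hW₇, hW₈⟩ := form_of_block_eq (a := d.A88) (b := d.B88) hN hM rfl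
    rfl e88
  have e77 : d.A77 * W₄ * d.B77 = d.E77 := projR_mul_sub_mul_projL_eq_zero_iff.1 c66'
  obtain ⟨c34, c35, Q₁, Q₂, hW₄⟩ := form_of_mul_mul_eq e77
  have e99 : d.A99 * W₄ * d.B99 = d.E99 := projR_mul_sub_mul_projL_eq_zero_iff.1 c88'
  obtain ⟨c36, c37, Q₃, Q₄, hW₄'⟩ := form_of_mul_mul_eq e99
  -- The stated form of `W4` subtracts the kernel terms.
  obtain ⟨Q₁, rfl⟩ := neg_surjective Q₁
  obtain ⟨Q₂, rfl⟩ := neg_surjective Q₂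
  rw [Matrix.mul_neg, Matrix.neg_mul, ← sub_eq_add_neg, ← sub_eq_add_neg] at hW₄
  have et := (eqEt_iff (U' := -Q₃) (Z' := -Q₄) hW₄).2 (by
    rw [neg_neg, neg_neg]; exact hW₄')
  obtain ⟨c38, K1, K2, K3, hQ₁, hQ₂⟩ := form_of_block_eq (a := d.At) (b := d.Bt) hN hM rfl rfl et
  refine ⟨⟨c1, c2, c3, c4, c5, c6, c7, c8, c9, c10, c11, c12, c13, tG.mixed, tG.mixed', tG.left,
    tG.right, tF.mixed, tF.mixed', tF.left, tF.right, t0.left, t0.mixed, t0.right, t0.mixed', c26,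
    c27, c28, c29, c30, c31, c32, c33, c34, c35, c36, c37, c38⟩, ?_⟩
  let p : Params δ := ⟨T11, T21, T31, T41, T51, J11, J21, J31, J41, J51, H11, H12, H13, H21, H22,
    H23, H31, H41, K1, W₂, H32, H33, H42, H43, K2, K3, W₃, W₁⟩
  -- The parametrized tensors are recovered from the innermost outwards, each using those before it.
  have w4 : d.W4 p = W₄ := by
    rw [W4, Q1, Q2, hW₄, hQ₁, hQ₂]
  have v2 : d.V2 p = V₂ := by
    rw [V2, W5, W6, w4, hV₂, hW₅, hW₆, sub_right_comm (_ * _ * _)]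
  have t2 : d.T2 p = T₂ := by
    rw [T2, W7, W8, w4, hT₂, hW₇, hW₈]
  have x3 : d.X3 p = u.X3 := by
    rw [X3, U1, U2, v2, hX3, hU₁, hU₂]
  have y3 : d.Y3 p = u.Y3 := by
    rw [Y3, U3, U4, t2, hY3, hU₃, hU₄]
  have u5 : d.U5 p = u.W := by
    rw [U5, V1, V3, v2, t2, hU, hV₁, hV₃]
  have w : d.W p = u.W := by rw [W, u5, ← hW]
  refine ⟨p, ?_⟩
  have g1 : d.A4† * d.E5 + projL d.A4 * d.V11 p = u.X1 := by
    rw [V11, Eg1, x3, w, ← hV11, ← hX1]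
  have g2 : d.E6 * d.B4† + d.V22 p * projR d.B4 = u.X2 := by
    rw [V22, Eg1, x3, w, ← hV22, ← hX2]
  have g3 : d.A5† * d.E7 + projL d.A5 * d.V33 p = u.Y1 := by
    rw [V33, Eg2, y3, w, ← hV33, ← hY1]
  have g4 : d.E8 * d.B5† + d.V44 p * projR d.B5 = u.Y2 := by
    rw [V44, Eg2, y3, w, ← hV44, ← hY2]
  rw [generalSolution, g1, g2, g3, g4, x3, y3, w]

/-- The solvability conditions imply that all values of the general solution are solutions. -/
theorem SolvabilityConditions.isSolution_generalSolution (hN : 0 < N) (hM : 0 < M)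
    (c : d.SolvabilityConditions) (p : Params δ) : d.IsSolution (d.generalSolution p) := by
  -- The chain is now climbed from its innermost end: the last condition makes the two forms of `W4`
  -- agree, so `W4` satisfies both of its equations.
  obtain ⟨Q₃, Q₄, et⟩ := exists_block_eq_of_form (a := d.At) (b := d.Bt) hN hM rfl rfl c.c38
    (X := d.Q1 p) (Y := d.Q2 p) rfl rfl
  have e77 : d.A77 * d.W4 p * d.B77 = d.E77 := by
    have h1 := mul_mul_eq_of_form c.c34 c.c35 (-d.Q1 p) (-d.Q2 p)
    rwa [Matrix.mul_neg, Matrix.neg_mul, ← sub_eq_add_neg, ← sub_eq_add_neg] at h1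
  have e99 : d.A99 * d.W4 p * d.B99 = d.E99 := by
    rw [(eqEt_iff (W := d.W4 p) rfl).1 et]
    exact mul_mul_eq_of_form c.c36 c.c37 _ _
  have hV2 : d.V2 p = d.A0† * d.E0 * d.B0† - d.A0† * d.C0 * d.M0† * d.E0 * d.B0†
      - d.A0† * d.S0 * d.C0† * d.E0 * d.N0† * d.D0 * d.B0†
      - d.A0† * d.S0 * d.W4 p * projR d.N0 * d.D0 * d.B0† + projL d.A0 * d.W5 p
      + d.W6 p * projR d.B0 := by
    rw [V2, sub_right_comm (_ * _ * _)]
  -- The equation `e77` is the solvability condition of the block equation for `V2`, which supplies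
  -- the second form of `V2`; likewise `e99` for `T2`.
  obtain ⟨Z₅, Z₆, e66⟩ := exists_block_eq_of_form (a := d.A66) (b := d.B66) hN hM rfl rfl
    (projR_mul_sub_mul_projL_eq_zero_iff.2 e77) (X := d.W5 p) (Y := d.W6 p) rfl rfl
  obtain ⟨Z₇, Z₈, e88⟩ := exists_block_eq_of_form (a := d.A88) (b := d.B88) hN hM rfl rfl
    (projR_mul_sub_mul_projL_eq_zero_iff.2 e99) (X := d.W7 p) (Y := d.W8 p) rfl rfl
  have e33 : d.A33 * d.V2 p * d.B33 = d.E33 := by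
    rw [(eqE66_iff hV2).1 e66]
    exact mul_mul_eq_of_form c.c30 c.c31 _ _
  have e55 : d.A55 * d.T2 p * d.B55 = d.E55 := by
    rw [(eqE88_iff (T := d.T2 p) rfl).1 e88]
    exact mul_mul_eq_of_form c.c32 c.c33 _ _
  have t0 : TwoTermConditions d.A0 d.B0 d.C0 d.D0 d.E0 := ⟨c.c22, c.c24, c.c23, c.c25⟩
  have e0 : d.A0 * d.V2 p * d.B0 + d.C0 * d.T2 p * d.D0 = d.E0 :=
    t0.eq_of_form (M := d.M0) (N := d.N0) (S := d.S0) rfl rfl rfl hV2 rfl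
  obtain ⟨T₁, T₃, e11⟩ := exists_block_eq_of_form' (a := d.A11) (b := d.B11) hN hM rfl rfl
    (eqE0_iff.2 e0) (X := d.V1 p) (Y := d.V3 p) rfl rfl
  obtain ⟨Z₁, Z₂, e22⟩ := exists_block_eq_of_form (a := d.A22) (b := d.B22) hN hM rfl rfl
    (projR_mul_sub_mul_projL_eq_zero_iff.2 e33) (X := d.U1 p) (Y := d.U2 p) rfl rfl
  obtain ⟨Z₃, Z₄, e44⟩ := exists_block_eq_of_form (a := d.A44) (b := d.B44) hN hM rfl rfl
    (projR_mul_sub_mul_projL_eq_zero_iff.2 e55) (X := d.U3 p) (Y := d.U4 p) rfl rfl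
  have tG : TwoTermConditions d.Ah4 d.Bh4 d.C6 d.D6 d.G := ⟨c.c16, c.c17, c.c14, c.c15⟩
  have tF : TwoTermConditions d.Ah5 d.Bh5 d.C7 d.D7 d.F := ⟨c.c20, c.c21, c.c18, c.c19⟩
  have eG : d.Ah4 * d.X3 p * d.Bh4 + d.C6 * d.U5 p * d.D6 = d.G :=
    tG.eq_of_form (M := d.M1) (N := d.N1) (S := d.S1) rfl rfl rfl
      ((eqE22_iff (X := d.X3 p) rfl).1 e22) rfl
  have eF : d.Ah5 * d.Y3 p * d.Bh5 + d.C7 * d.U5 p * d.D7 = d.F :=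
    tF.eq_of_form (M := d.M2) (N := d.N2) (S := d.S2) rfl rfl rfl
      ((eqE44_iff (Y := d.Y3 p) rfl).1 e44) ((eqE11_iff (U := d.U5 p) rfl).1 e11)
  have hW := mul_eq_and_eq_mul_of_form c.c11 c.c12 c.c13 (d.U5 p)
  -- The equations `eG` and `eF` supply the one condition of each outer two-term equation that
  -- depends on `X3`, `Y3` and `W`.
  have t9 := twoTermConditions_sub_iff.2 ⟨c.c5, c.c6, c.c7, (eqG_iff (W := d.W p) rfl).2 eG⟩
  have t10 := twoTermConditions_sub_iff.2 ⟨c.c8, c.c9, c.c10, (eqF_iff (W := d.W p) rfl).2 eF⟩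
  exact
    { eq1 := mul_mul_eq_of_form c.c26 c.c27 _ _
      eq2 := mul_mul_eq_of_form c.c28 c.c29 _ _
      eq3 := mul_eq_of_form c.c1 _
      eq4 := eq_mul_of_form c.c2 _
      eq5 := mul_eq_of_form c.c3 _
      eq6 := eq_mul_of_form c.c4 _
      eq7 := hW.1
      eq8 := hW.2
      eq9 := (eq9_iff (u := d.generalSolution p) rfl rfl).2
        (t9.eq_of_form (M := d.M11) (N := d.N11) (S := d.S11) rfl rfl rfl rfl rfl)
      eq10 := (eq10_iff (u := d.generalSolution p) rfl rfl).2
        (t10.eq_of_form (M := d.M22) (N := d.N22) (S := d.S22) rfl rfl rfl rfl rfl) }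

end SystemData

end QTensor

theorem theorem3p2 {N M : ℕ} (hN : 0 < N) (hM : 0 < M) (δ : QTensor.Dims N M)
    (d : QTensor.SystemData δ) :
    ((∃ u : QTensor.Unknowns δ, d.IsSolution u) ↔ d.SolvabilityConditions) ∧
    (d.SolvabilityConditions →
      ∀ u : QTensor.Unknowns δ,
        d.IsSolution u ↔ ∃ p : QTensor.Params δ, u = d.generalSolution p) := by
  refine ⟨⟨fun ⟨u, h⟩ => (h.conditions_and_form hN hM).1, fun c =>
    -- All parameter values give solutions, so zero parameters suffice for existence.
    ⟨_, c.isSolution_generalSolution hN hM ⟨0, 0, 0, 0, 0, 0, 0, 0, 0, 0, 0, 0, 0, 0, 0, 0, 0, 0,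
      0, 0, 0, 0, 0, 0, 0, 0, 0, 0⟩⟩⟩, fun c u => ⟨fun h => (h.conditions_and_form hN hM).2, ?_⟩⟩
  rintro ⟨p, rfl⟩
  exact c.isSolution_generalSolution hN hM p
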